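/- Let $n\ge 1$, let $\alpha_{ijk}\in\mathbf Z$ ($0\le i,j,k\le n$), put $F(x,y,z)=\sum_{i,j,k}\alpha_{ijk}x_iy_jz_k$, and suppose that $F=0$ defines a smooth hypersurface $V\subset\mathbf P^n_{\mathbf Q}\times\mathbf P^n_{\mathbf Q}\times\mathbf P^n_{\mathbf Q}$. Let $p$ be a prime. For $q\ge1$ put $$A(q)=q^{-3n-3}\sum_{\substack{0\le a<q\\ \gcd(a,q)=1}}\ \sum_{b\in(\mathbf Z/q\mathbf Z)^{3n+3}}e^{2\pi i aF(b)/q},\qquad \sigma_p=\sum_{k\ge0}A(p^k),$$ and for $r\ge 1$ let $N^*(r)$ be the number of $(x,y,z)\in(\mathbf Z/p^r\mathbf Z)^{3n+3}$ with $x\not\equiv0$, $y\not\equiv0$, $z\not\equiv0\pmod p$ and $F(x,y,z)\equiv0\pmod{p^r}$. Let $\omega_{L,p}$ be the Leray measure on the smooth locus of the affine cone $\{F=0\}\subset\mathbf Q_p^{3n+3}$: where the partial derivative $\partial F/\partial t_m$ with respect to one of the $3n+3$ coordinates $t=(x,y,z)$ does not vanish, it is $|\partial F/\partial t_m|_p^{-1}\prod_{l\ne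 m}dt_l$, with $dt_l$ the Haar measure of $\mathbf Q_p$ giving mass $1$ to $\mathbf Z_p$. Let $\tau_p=(1-\frac1p)^3\omega_p$, where $\omega_p$ is the measure on $V(\mathbf Q_p)$ which, in the coordinates normalised by $x_{i_0}=y_{j_0}=z_{k_0}=1$ and where $\partial F/\partial t_m\neq0$ for another coordinate $t_m$, is $$\omega_p=\frac{\prod_l dt_l}{\max_i|x_i|_p^n\,\max_j|y_j|_p^n\,\max_k|z_k|_p^n\,|\partial F/\partial t_m|_p},$$ the product being over the $3n-1$ coordinates other than $x_{i_0},y_{j_0},z_{k_0},t_m$. Then the series $\sigma_p$ converges absolutely, the integrals and volumes below are finite, and $$\sigma_p=\int_{\substack{(x,y,z)\in\mathbf Z_p^{3n+3}\\F(x,y,z)=0}}\omega_{L,p},\qquad \int_{\substack{(x,y,z)\in\mathbf Z_p^{3n+3},\ F(x,y,z)=0\\x\not\equiv0,\ y\not\equiv0,\ z\not\equiv0\ (p)}}\omega_{L,p} =\Bigl(1-\frac1{p^n}\Bigr)^3\int_{\substack{(x,y,z)\in\mathbf Z_p^{3n+3}\\F(x,y,z)=0}}\omega_{L,p},$$ $$\lim_{r\to\infty}\frac{N^*(r)}{p^{r(3n+2)}}=\Bigl(1-\frac1{p^n}\Bigr)^3\sigma_p,\qquad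 \tau_p(V(\mathbf Q_p))=\Bigl(1-\frac1{p^n}\Bigr)^3\sigma_p .$$ -/

import Mathlib

open MeasureTheory Filter Topology
open scoped ENNReal LinearAlgebra.Projectivization

namespace TriProj

/-! ### Trilinear forms and hypersurfaces of `ℙⁿ × ℙⁿ × ℙⁿ` -/

/-- Indices of the `3n+3` coordinates: `(0, i)`, `(1, j)`, `(2, k)` are the indices of
`x_i`, `y_j`, `z_k` respectively. -/
abbrev Coord (n : ℕ) : Type := Fin 3 × Fin (n + 1)

/-- The trilinear form `F(x, y, z) = ∑ α_{ijk} x_i y_j z_k`. -/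
noncomputable def form {n : ℕ} (α : Fin (n + 1) → Fin (n + 1) → Fin (n + 1) → ℤ) :
    MvPolynomial (Coord n) ℤ :=
  ∑ i, ∑ j, ∑ k, MvPolynomial.C (α i j k) *
    (MvPolynomial.X (0, i) * MvPolynomial.X (1, j) * MvPolynomial.X (2, k))

/-- The value `F(t)` at a point `t = (x, y, z)` with coordinates in a commutative ring. -/
noncomputable def F {n : ℕ} (α : Fin (n + 1) → Fin (n + 1) → Fin (n + 1) → ℤ)
    {R : Type*} [CommRing R] (t : Coord n → R) : R :=
  MvPolynomial.aeval t (form α)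

/-- The value `∂F/∂t_m (t)` of a partial derivative of `F`; for `m = (2, k)`, `(1, j)`, `(0, i)`
this is `B_k(x, y)`, `B'_j(x, z)`, `B''_i(y, z)` respectively. -/
noncomputable def dF {n : ℕ} (α : Fin (n + 1) → Fin (n + 1) → Fin (n + 1) → ℤ)
    {R : Type*} [CommRing R] (m : Coord n) (t : Coord n → R) : R :=
  MvPolynomial.aeval t (MvPolynomial.pderiv m (form α))

/-- `V = {F = 0}` is a smooth hypersurface of `ℙⁿ × ℙⁿ × ℙⁿ`: it has no singular geometric point
(Jacobian criterion, in multihomogeneous coordinates). -/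
def IsSmoothHypersurface {n : ℕ} (α : Fin (n + 1) → Fin (n + 1) → Fin (n + 1) → ℤ) : Prop :=
  ∀ t : Coord n → ℂ, (∀ s, ∃ i, t (s, i) ≠ 0) → F α t = 0 → ∃ m, dF α m t ≠ 0

/-! ### The local density -/

/-- `A(q) = q^{-3n-3} ∑_{0 ≤ a < q, gcd(a,q) = 1} ∑_{b ∈ (ℤ/q)^{3n+3}} e(a F(b) / q)`, where
`ZMod.stdAddChar x = exp (2 π i x / q)`. -/
noncomputable def A {n : ℕ} (α : Fin (n + 1) → Fin (n + 1) → Fin (n + 1) → ℤ)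
    (q : ℕ) [NeZero q] : ℂ :=
  ((q : ℂ) ^ (3 * n + 3))⁻¹ * ∑ a ∈ (Finset.range q).filter (fun a => Nat.gcd a q = 1),
    ∑ b : Coord n → ZMod q, ZMod.stdAddChar ((a : ZMod q) * F α b)

instance neZeroOfPrime (p : ℕ) [hp : Fact p.Prime] : NeZero p := ⟨hp.out.ne_zero⟩

/-- The local density `σ_p = ∑_{k ≥ 0} A(p^k)`. -/
noncomputable def localDensity {n : ℕ} (α : Fin (n + 1) → Fin (n + 1) → Fin (n + 1) → ℤ)
    (p : ℕ) [Fact p.Prime] : ℂ :=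
  ∑' k : ℕ, A α (p ^ k)

/-- `N*(r)`: the number of `(x, y, z)` modulo `p^r` with none of `x, y, z` divisible by `p`
and `F(x, y, z) ≡ 0 mod p^r`. -/
noncomputable def primCount {n : ℕ} (α : Fin (n + 1) → Fin (n + 1) → Fin (n + 1) → ℤ)
    (p r : ℕ) : ℕ :=
  Nat.card {t : Coord n → ZMod (p ^ r) //
    (∀ s, ∃ i, ¬ (p : ZMod (p ^ r)) ∣ t (s, i)) ∧ F α t = 0}

/-! ### Measures over `ℚ_p` -/

section Padic

variable (p : ℕ) [Fact p.Prime]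

noncomputable instance padicMeasurableSpace : MeasurableSpace ℚ_[p] := borel ℚ_[p]

instance padicBorelSpace : BorelSpace ℚ_[p] := ⟨rfl⟩

/-- The Haar measure on `ℚ_p` giving mass `1` to `ℤ_p`. -/
noncomputable def haar : Measure ℚ_[p] :=
  Measure.addHaarMeasure
    { carrier := Metric.closedBall 0 1
      isCompact' := isCompact_closedBall 0 1
      interior_nonempty' :=
        ⟨0, Metric.ball_subset_interior_closedBall (Metric.mem_ball_self one_pos)⟩ }

end Padic

/-- Replace the coordinate `t_m` by the solution of `F = 0`. As `F` has degree one in `t_m`,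
we have `F(t) = t_m * ∂F/∂t_m + F(t with t_m = 0)`, where `∂F/∂t_m` does not depend on `t_m`. So if
`∂F/∂t_m ≠ 0`, this is the only point of `{F = 0}` with the same coordinates as `t` outside `m`. -/
noncomputable def solve {n : ℕ} (α : Fin (n + 1) → Fin (n + 1) → Fin (n + 1) → ℤ)
    {K : Type*} [Field K] (m : Coord n) (t : Coord n → K) : Coord n → K :=
  Function.update t m (-F α (Function.update t m 0) / dF α m t)

/-- The point of `{F = 0}` whose coordinates other than the `m`-th are the given `u`:
on `{∂F/∂t_m ≠ 0}`, the cone `{F = 0}` is the graph parametrised by this map. -/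
noncomputable def conePoint {n : ℕ} (α : Fin (n + 1) → Fin (n + 1) → Fin (n + 1) → ℤ)
    {K : Type*} [Field K] (m : Coord n) (u : {l : Coord n // l ≠ m} → K) : Coord n → K :=
  solve α m (fun l => if h : l ≠ m then u ⟨l, h⟩ else 0)

/-- The Leray measure `ω_{L,p}` on the smooth locus of the affine cone `F = 0` in `ℚ_p^{3n+3}`
(as a measure on `ℚ_p^{3n+3}`). On the chart `{∂F/∂t_m ≠ 0}` it is
`|∂F/∂t_m|_p⁻¹ ∏_{l ≠ m} dt_l`; it is glued from the charts by using at each smooth point the first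
`m` (in lexicographic order) such that `∂F/∂t_m ≠ 0`. -/
noncomputable def leray {n : ℕ} (α : Fin (n + 1) → Fin (n + 1) → Fin (n + 1) → ℤ)
    (p : ℕ) [Fact p.Prime] : Measure (Coord n → ℚ_[p]) :=
  ∑ m : Coord n,
    (((Measure.pi fun _ : {l : Coord n // l ≠ m} => haar p).restrict
        {u | dF α m (conePoint α m u) ≠ 0 ∧
          ∀ l : Coord n, toLex l < toLex m → dF α l (conePoint α m u) = 0}).withDensity
      fun u => (‖dF α m (conePoint α m u)‖ₑ)⁻¹).map (conePoint α m)

/-- The `p`-adically integral points of the affine cone: `(x, y, z) ∈ ℤ_p^{3n+3}`, `F = 0`. -/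
noncomputable def integralCone {n : ℕ} (α : Fin (n + 1) → Fin (n + 1) → Fin (n + 1) → ℤ)
    (p : ℕ) [Fact p.Prime] : Set (Coord n → ℚ_[p]) :=
  {t | (∀ l, ‖t l‖ ≤ 1) ∧ F α t = 0}

/-- The points of the integral cone with `x ≢ 0`, `y ≢ 0`, `z ≢ 0` modulo `p`. -/
noncomputable def primitiveCone {n : ℕ} (α : Fin (n + 1) → Fin (n + 1) → Fin (n + 1) → ℤ)
    (p : ℕ) [Fact p.Prime] : Set (Coord n → ℚ_[p]) :=
  {t | t ∈ integralCone α p ∧ ∀ s, ∃ i, ‖t (s, i)‖ = 1}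

/-! ### The Tamagawa measure on `V(ℚ_p)` -/

/-- The σ-algebra on a projective space: the quotient of the one on the nonzero vectors. -/
instance projectivizationMeasurableSpace {K W : Type*} [DivisionRing K] [AddCommGroup W]
    [Module K W] [MeasurableSpace W] : MeasurableSpace (ℙ K W) :=
  MeasurableSpace.map (Projectivization.mk' K) inferInstance

/-- Charts of `V`: the choice `c` of one index in each of the three blocks (where the homogeneous
coordinates `x_{c 0}`, `y_{c 1}`, `z_{c 2}` are normalised to `1`) and of another index `m`, for
which `∂F/∂t_m ≠ 0` on the chart. -/
abbrev Chart (n : ℕ) : Type :=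
  {q : (Fin 3 → Fin (n + 1)) × Coord n // q.2.2 ≠ q.1 q.2.1}

/-- The indices of the `3n-1` local coordinates of `V` in a chart. -/
abbrev Chart.Param {n : ℕ} (q : Chart n) : Type :=
  {l : Coord n // l.2 ≠ q.1.1 l.1 ∧ l ≠ q.1.2}

/-- The normalised homogeneous coordinates `(u, v, w)` of the point of `V` with given local
coordinates in a chart. -/
noncomputable def chartPoint {n : ℕ} (α : Fin (n + 1) → Fin (n + 1) → Fin (n + 1) → ℤ)
    {K : Type*} [Field K] (q : Chart n) (u : q.Param → K) : Coord n → K :=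
  solve α q.1.2 (fun l => if l.2 = q.1.1 l.1 then 1 else
    if h : l.2 ≠ q.1.1 l.1 ∧ l ≠ q.1.2 then u ⟨l, h⟩ else 0)

theorem chartPoint_block_ne_zero {n : ℕ} (α : Fin (n + 1) → Fin (n + 1) → Fin (n + 1) → ℤ)
    {K : Type*} [Field K] (q : Chart n) (u : q.Param → K) (s : Fin 3) :
    (fun i => chartPoint α q u (s, i)) ≠ 0 := by
  intro h
  have h1 := congrFun h (q.1.1 s)
  have hne : ((s, q.1.1 s) : Coord n) ≠ q.1.2 := by
    intro h2
    apply q.2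
    rw [← h2]
  simp [chartPoint, solve, Function.update_of_ne hne] at h1

/-- The same point as an element of `ℙⁿ × ℙⁿ × ℙⁿ`. -/
noncomputable def chartMap {n : ℕ} (α : Fin (n + 1) → Fin (n + 1) → Fin (n + 1) → ℤ)
    {K : Type*} [Field K] (q : Chart n) (u : q.Param → K) :
    Fin 3 → ℙ K (Fin (n + 1) → K) :=
  fun s => Projectivization.mk K _ (chartPoint_block_ne_zero α q u s)

/-- `h_p(x, y, z) = max |x_i|^n * max |y_j|^n * max |z_k|^n`. -/
noncomputable def height {n : ℕ} {p : ℕ} [Fact p.Prime] (t : Coord n → ℚ_[p]) : ℝ≥0∞ :=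
  ∏ s : Fin 3, (⨆ i, ‖t (s, i)‖ₑ) ^ n

/-- The measure `ω_p` on `V(ℚ_p)` (as a measure on `ℙⁿ(ℚ_p)³`). In each chart it is
`(h_p |∂F/∂t_m|_p)⁻¹ ∏ dt_l`, the product being over the local coordinates of the chart; it is glued
from the charts by using, at each point of `V(ℚ_p)`, for `c` the first nonvanishing coordinate in
each block, and for `m` the first admissible index (in lexicographic order) such that
`∂F/∂t_m ≠ 0`. -/
noncomputable def omega {n : ℕ} (α : Fin (n + 1) → Fin (n + 1) → Fin (n + 1) → ℤ)
    (p : ℕ) [Fact p.Prime] : Measure (Fin 3 → ℙ ℚ_[p] (Fin (n + 1) → ℚ_[p])) :=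
  ∑ q : Chart n,
    (((Measure.pi fun _ : q.Param => haar p).restrict
        {u | dF α q.1.2 (chartPoint α q u) ≠ 0 ∧
          (∀ l : Coord n, l.2 ≠ q.1.1 l.1 → toLex l < toLex q.1.2 →
            dF α l (chartPoint α q u) = 0) ∧
          ∀ s, ∀ i < q.1.1 s, chartPoint α q u (s, i) = 0}).withDensity
      fun u => (height (chartPoint α q u) * ‖dF α q.1.2 (chartPoint α q u)‖ₑ)⁻¹).map
        (chartMap α q)

/-- The Tamagawa measure `τ_p = (1 - 1/p)^3 ω_p`. -/
noncomputable def tamagawa {n : ℕ} (α : Fin (n + 1) → Fin (n + 1) → Fin (n + 1) → ℤ)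
    (p : ℕ) [Fact p.Prime] : Measure (Fin 3 → ℙ ℚ_[p] (Fin (n + 1) → ℚ_[p])) :=
  ENNReal.ofReal ((1 - 1 / (p : ℝ)) ^ 3) • omega α p

/-- `V(ℚ_p)` as a subset of `ℙⁿ(ℚ_p)³`. -/
noncomputable def padicPoints {n : ℕ} (α : Fin (n + 1) → Fin (n + 1) → Fin (n + 1) → ℤ)
    (p : ℕ) [Fact p.Prime] : Set (Fin 3 → ℙ ℚ_[p] (Fin (n + 1) → ℚ_[p])) :=
  {P | F α (fun l : Coord n => (P l.1).rep l.2) = 0}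

end TriProj

/-! Everything is read off from the normalised volumes `dens α p T r`, taken over the integral
points whose blocks with index in `T` are primitive, with `|F| ≤ p⁻ʳ`. Counting residues, `T = univ`
gives `N*(r) / p^(r(3n+2))` for `r > 0`. A Ramanujan sum shows that `A(p^(k+1))` is the difference
of the values at `k+1` and `k` for `T = ∅`, so the partial sums of `σ_p` telescope to these
densities (`A_zero`, `A_succ`).

The link with the Leray measure is that `F` has degree at most one in each coordinate. Where
`∂F/∂t_m ≠ 0`, the condition `|F| ≤ p⁻ʳ` cuts out of each line in direction `t_m` a ball of volume
`p⁻ʳ / |∂F/∂t_m|` around the point of the cone. Hence on a compact open set without singular zeros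
the normalised volume equals the Leray mass exactly, once `r` is large
(`exists_vol_inter_tube_eq_lam`, `exists_vol_inter_tube_eq_leray`). As the volume knows nothing of
charts, this also proves that the chart measures agree on overlaps (`lam_eq_lam`).

Smoothness, carried from `ℂ` to `ℚ_p` by an abstract field embedding, makes this applicable to
primitive points. The full box contains singular zeros such as the origin, and is reached by
homogeneity: multiplying one block by `p` multiplies volume by `p^(-n-1)` and `F` by `p`, hence
normalised volume by `p⁻ⁿ`. For the Leray measure, a decomposition into shells and three geometric
series give the factor `(1 - p⁻ⁿ)⁻³` (`leray_box`). For the densities, the recursion `dens_succ`,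
used once per block, gives absolute convergence and the same factor in the limit (`tendsto_dens`).

Finally the primitive cone fibres over `V(ℚ_p)` by rescaling the three blocks. In chart coordinates
the Leray measure splits, and integrating over the scaling parameters leaves `(1 - 1/p)^3` times the
density of `ω_p` (`lintegral_scale_box`, `tamagawa_padicPoints`). -/

namespace TriProj

/-! ### Identities for the trilinear form and its partial derivatives. -/

section Algebra

variable {n : ℕ} (α : Fin (n + 1) → Fin (n + 1) → Fin (n + 1) → ℤ) {R : Type*} [CommRing R]

theorem F_eq_sum (t : Coord n → R) :
    F α t = ∑ i, ∑ j, ∑ k, (α i j k : R) * (t (0, i) * t (1, j) * t (2, k)) := by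
  simp [F, form]

theorem dF_eq_sum (m : Coord n) (t : Coord n → R) :
    dF α m t = ∑ i, ∑ j, ∑ k, (α i j k : R) *
      ((if m = (0, i) then 1 else 0) * t (1, j) * t (2, k) +
        t (0, i) * (if m = (1, j) then 1 else 0) * t (2, k) +
        t (0, i) * t (1, j) * (if m = (2, k) then 1 else 0)) := by
  simp only [dF, form, map_sum]
  refine Finset.sum_congr rfl fun i _ => Finset.sum_congr rfl fun j _ =>
    Finset.sum_congr rfl fun k _ => ?_
  simp only [Derivation.leibniz, MvPolynomial.pderiv_X, MvPolynomial.pderiv_C, smul_eq_mul, map_mul,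
    map_add, MvPolynomial.aeval_X, MvPolynomial.aeval_C, Pi.single_apply, mul_zero, add_zero,
    apply_ite (MvPolynomial.aeval t), map_one, map_zero, @eq_comm _ _ m]
  simp only [algebraMap_int_eq, eq_intCast]
  ring

theorem map_F {S : Type*} [CommRing S] (φ : R →+* S) (t : Coord n → R) :
    F α (fun l => φ (t l)) = φ (F α t) := by
  simp [F_eq_sum]

theorem map_dF {S : Type*} [CommRing S] (φ : R →+* S) (m : Coord n) (t : Coord n → R) :
    dF α m (fun l => φ (t l)) = φ (dF α m t) := by
  simp [dF_eq_sum, apply_ite φ]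

/-- Each monomial takes exactly one variable from each block, so no coordinate occurs to a power
above the first. -/
theorem F_update (m : Coord n) (t : Coord n → R) (x : R) :
    F α (Function.update t m x) = x * dF α m t + F α (Function.update t m 0) := by
  simp only [F_eq_sum, dF_eq_sum, Finset.mul_sum, ← Finset.sum_add_distrib]
  refine Finset.sum_congr rfl fun i _ => Finset.sum_congr rfl fun j _ =>
    Finset.sum_congr rfl fun k _ => ?_
  obtain ⟨s, l⟩ := m
  fin_cases s
  · by_cases h : i = l
    · simp [Prod.ext_iff, h]; ring
    · simp [Prod.ext_iff, h, Ne.symm h]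
  · by_cases h : j = l
    · simp [Prod.ext_iff, h]; ring
    · simp [Prod.ext_iff, h, Ne.symm h]
  · by_cases h : k = l
    · simp [Prod.ext_iff, h]; ring
    · simp [Prod.ext_iff, h, Ne.symm h]

theorem dF_update (m : Coord n) (t : Coord n → R) (x : R) :
    dF α m (Function.update t m x) = dF α m t := by
  simp only [dF_eq_sum]
  refine Finset.sum_congr rfl fun i _ => Finset.sum_congr rfl fun j _ =>
    Finset.sum_congr rfl fun k _ => ?_
  obtain ⟨s, l⟩ := m
  fin_cases s <;> simp [Function.update_apply, Prod.ext_iff]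

/-- Multiply the three blocks of coordinates by `c 0`, `c 1`, `c 2`. -/
def scale (c : Fin 3 → R) (t : Coord n → R) : Coord n → R := fun l => c l.1 * t l

theorem F_scale (c : Fin 3 → R) (t : Coord n → R) :
    F α (scale c t) = (∏ s, c s) * F α t := by
  simp only [F_eq_sum, Finset.mul_sum, Fin.prod_univ_three, scale]
  refine Finset.sum_congr rfl fun i _ => Finset.sum_congr rfl fun j _ =>
    Finset.sum_congr rfl fun k _ => ?_
  ring

/-- A derivative in the block `m.1` is bilinear in the two other blocks and free of its own. -/
theorem dF_scale (m : Coord n) (c : Fin 3 → R) (t : Coord n → R) :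
    dF α m (scale c t) = (∏ s ∈ Finset.univ.erase m.1, c s) * dF α m t := by
  simp only [dF_eq_sum, Finset.mul_sum, scale]
  refine Finset.sum_congr rfl fun i _ => Finset.sum_congr rfl fun j _ =>
    Finset.sum_congr rfl fun k _ => ?_
  obtain ⟨s, l⟩ := m
  have h0 : (Finset.univ : Finset (Fin 3)).erase 0 = {1, 2} := by decide
  have h1 : (Finset.univ : Finset (Fin 3)).erase 1 = {0, 2} := by decide
  have h2 : (Finset.univ : Finset (Fin 3)).erase 2 = {0, 1} := by decide
  fin_cases s <;> simp [Prod.ext_iff, h0, h1, h2] <;> split_ifs <;> ring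

/-- Euler's relation for a single block, in which `F` is linear. -/
theorem sum_mul_dF (s : Fin 3) (t : Coord n → R) :
    ∑ i, t (s, i) * dF α (s, i) t = F α t := by
  simp only [F_eq_sum, dF_eq_sum, Finset.mul_sum]
  rw [Finset.sum_comm]
  refine Finset.sum_congr rfl fun i _ => ?_
  rw [Finset.sum_comm]
  refine Finset.sum_congr rfl fun j _ => ?_
  rw [Finset.sum_comm]
  refine Finset.sum_congr rfl fun k _ => ?_
  fin_cases s <;> simp [Prod.ext_iff] <;> ring

end Algebra

/-! ### Solving `F = 0` for one coordinate. -/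

section Solve

variable {n : ℕ} (α : Fin (n + 1) → Fin (n + 1) → Fin (n + 1) → ℤ) {K : Type*} [Field K]

theorem dF_solve (m : Coord n) (t : Coord n → K) : dF α m (solve α m t) = dF α m t :=
  dF_update α m t _

theorem F_solve (m : Coord n) (t : Coord n → K) (h : dF α m t ≠ 0) : F α (solve α m t) = 0 := by
  rw [solve, F_update, div_mul_cancel₀ _ h, neg_add_cancel]

end Solve

/-! ### Transfer of smoothness from `ℂ` to `ℚ_p`. -/

/-- By Steinitz, an algebraic closure of `ℚ_p` is isomorphic to `ℂ`: both are algebraically closed,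
of characteristic zero and of the cardinality of the continuum. No topology is involved. -/
theorem nonempty_ringHom_padic_complex (p : ℕ) [Fact p.Prime] : Nonempty (ℚ_[p] →+* ℂ) := by
  have h1 : Cardinal.mk ℚ_[p] = Cardinal.continuum := by
    refine le_antisymm ?_ (continuum_le_cardinal_of_nontriviallyNormedField _)
    have h : Function.Surjective (Quotient.mk _ : PadicSeq p → ℚ_[p]) := Quotient.mk_surjective
    refine (Cardinal.mk_le_of_surjective h).trans ?_
    refine (Cardinal.mk_subtype_le _).trans ?_
    simp
  have h2 : Cardinal.mk (AlgebraicClosure ℚ_[p]) = Cardinal.continuum := by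
    refine le_antisymm ?_ ?_
    · refine (Algebra.IsAlgebraic.cardinalMk_le_max ℚ_[p] _).trans ?_
      simp [h1, Cardinal.aleph0_le_continuum]
    · rw [← h1]
      exact Cardinal.mk_le_of_injective (algebraMap ℚ_[p] (AlgebraicClosure ℚ_[p])).injective
  obtain ⟨e⟩ := IsAlgClosed.ringEquiv_of_equiv_of_charZero
    (K := AlgebraicClosure ℚ_[p]) (L := ℂ) (by rw [h2]; exact Cardinal.aleph0_lt_continuum)
    (Cardinal.eq.1 (by rw [h2, Cardinal.mk_complex]))
  exact ⟨(e : AlgebraicClosure ℚ_[p] →+* ℂ).comp (algebraMap _ _)⟩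

theorem IsSmoothHypersurface.exists_dF_ne_zero {n : ℕ}
    {α : Fin (n + 1) → Fin (n + 1) → Fin (n + 1) → ℤ} (hV : IsSmoothHypersurface α)
    (p : ℕ) [Fact p.Prime] (t : Coord n → ℚ_[p]) (ht : ∀ s, ∃ i, t (s, i) ≠ 0)
    (hF : F α t = 0) : ∃ m, dF α m t ≠ 0 := by
  obtain ⟨φ⟩ := nonempty_ringHom_padic_complex p
  obtain ⟨m, hm⟩ := hV (fun l => φ (t l))
    (fun s => (ht s).imp fun i hi => by simpa using hi) (by rw [map_F, hF, map_zero])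
  refine ⟨m, fun h => hm ?_⟩
  rw [map_dF, h, map_zero]

/-! ### Haar measure on `ℚ_p`: balls, residue classes and scaling. -/

section Haar

variable (p : ℕ) [hp : Fact p.Prime]

/-- Reduction modulo `p ^ r` of `p`-adic integers, extended by zero. -/
noncomputable def red (r : ℕ) (x : ℚ_[p]) : ZMod (p ^ r) :=
  if h : ‖x‖ ≤ 1 then PadicInt.toZModPow r (⟨x, h⟩ : ℤ_[p]) else 0

instance isAddHaarMeasure_haar : (haar p).IsAddHaarMeasure :=
  inferInstanceAs (Measure.addHaarMeasure _).IsAddHaarMeasure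

theorem haar_closedBall_zero_one : haar p (Metric.closedBall 0 1) = 1 :=
  Measure.addHaarMeasure_self

theorem haar_closedBall_eq (a : ℚ_[p]) (R : ℝ) :
    haar p (Metric.closedBall a R) = haar p (Metric.closedBall 0 R) := by
  have : Metric.closedBall a R = (fun x => -a + x) ⁻¹' Metric.closedBall 0 R := by
    ext x; simp [dist_eq_norm, sub_eq_neg_add]
  rw [this, measure_preimage_add]

variable {p}

theorem norm_natCast_le_one (a : ℕ) : ‖(a : ℚ_[p])‖ ≤ 1 := by
  simpa using Padic.norm_int_le_one (p := p) a

theorem norm_sub_le_one {x y : ℚ_[p]} (hx : ‖x‖ ≤ 1) (hy : ‖y‖ ≤ 1) : ‖x - y‖ ≤ 1 := by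
  have := IsUltrametricDist.norm_add_le_max x (-y)
  rw [norm_neg, ← sub_eq_add_neg] at this
  exact this.trans (max_le hx hy)

theorem exists_padicInt {x : ℚ_[p]} (hx : ‖x‖ ≤ 1) : ∃ y : ℤ_[p], (y : ℚ_[p]) = x :=
  ⟨⟨x, hx⟩, rfl⟩

theorem red_coe (r : ℕ) (x : ℤ_[p]) : red p r x = PadicInt.toZModPow r x :=
  dif_pos x.2

theorem red_eq_zero_iff {r : ℕ} {x : ℚ_[p]} (hx : ‖x‖ ≤ 1) :
    red p r x = 0 ↔ ‖x‖ ≤ (p : ℝ) ^ (-r : ℤ) := by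
  obtain ⟨x, rfl⟩ := exists_padicInt hx
  rw [red_coe, ← RingHom.mem_ker, PadicInt.ker_toZModPow, ← PadicInt.norm_le_pow_iff_mem_span_pow,
    PadicInt.norm_def]

theorem red_natCast (r a : ℕ) : red p r (a : ℚ_[p]) = a := by
  rw [← PadicInt.coe_natCast, red_coe, map_natCast]

theorem red_sub {r : ℕ} {x y : ℚ_[p]} (hx : ‖x‖ ≤ 1) (hy : ‖y‖ ≤ 1) :
    red p r (x - y) = red p r x - red p r y := by
  obtain ⟨x, rfl⟩ := exists_padicInt hx
  obtain ⟨y, rfl⟩ := exists_padicInt hy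
  rw [← PadicInt.coe_sub, red_coe, red_coe, red_coe, map_sub]

theorem red_eq_iff {r : ℕ} {x : ℚ_[p]} (hx : ‖x‖ ≤ 1) (a : ZMod (p ^ r)) :
    red p r x = a ↔ ‖x - a.val‖ ≤ (p : ℝ) ^ (-r : ℤ) := by
  have h : ‖x - a.val‖ ≤ 1 := norm_sub_le_one hx (norm_natCast_le_one _)
  rw [← red_eq_zero_iff h, red_sub hx (norm_natCast_le_one _), red_natCast, ZMod.natCast_zmod_val,
    sub_eq_zero]

theorem pow_neg_le_one (r : ℕ) : (p : ℝ) ^ (-r : ℤ) ≤ 1 :=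
  zpow_le_one_of_nonpos₀ (by exact_mod_cast hp.out.one_le) (by simp)

theorem norm_le_one_of_sub_le {r : ℕ} {x : ℚ_[p]} {a : ℕ} (h : ‖x - a‖ ≤ (p : ℝ) ^ (-r : ℤ)) :
    ‖x‖ ≤ 1 := by
  have := (IsUltrametricDist.norm_add_le_max (x - a) (a : ℚ_[p])).trans
    (max_le (h.trans (pow_neg_le_one r)) (norm_natCast_le_one (p := p) a))
  simpa using this

theorem setOf_red_eq (r : ℕ) (a : ZMod (p ^ r)) :
    {x : ℚ_[p] | ‖x‖ ≤ 1 ∧ red p r x = a} = Metric.closedBall (a.val : ℚ_[p]) (p ^ (-r : ℤ)) := by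
  ext x
  simp only [Set.mem_ofPred_eq, mem_closedBall_iff_norm]
  exact ⟨fun h => (red_eq_iff h.1 a).1 h.2, fun h =>
    ⟨norm_le_one_of_sub_le h, (red_eq_iff (norm_le_one_of_sub_le h) a).2 h⟩⟩

/-- The unit ball, of mass `1`, is the disjoint union of `p ^ r` residue classes, which are
translates of one another. -/
theorem haar_closedBall_pow_neg (a : ℚ_[p]) (r : ℕ) :
    haar p (Metric.closedBall a (p ^ (-r : ℤ))) = ((p : ℝ≥0∞) ^ r)⁻¹ := by
  have h1 : Metric.closedBall (0 : ℚ_[p]) 1 =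
      ⋃ a : ZMod (p ^ r), {x : ℚ_[p] | ‖x‖ ≤ 1 ∧ red p r x = a} := by
    ext x; simp
  have h2 := haar_closedBall_zero_one p
  rw [h1, measure_iUnion] at h2
  · simp only [setOf_red_eq, haar_closedBall_eq p (ZMod.val _ : ℚ_[p])] at h2
    simp only [tsum_fintype, Finset.sum_const, Finset.card_univ, ZMod.card, nsmul_eq_mul] at h2
    rw [haar_closedBall_eq]
    refine ENNReal.eq_inv_of_mul_eq_one_left ?_
    rw [mul_comm]; exact_mod_cast h2
  · intro a b hab
    exact Set.disjoint_left.2 fun x hx hy => hab (hx.2.symm.trans hy.2)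
  · intro a
    rw [setOf_red_eq]
    exact Metric.isClosed_closedBall.measurableSet

theorem enorm_pow_neg (r : ℕ) : ‖(p : ℚ_[p]) ^ r‖ₑ = ((p : ℝ≥0∞) ^ r)⁻¹ := by
  rw [enorm_pow, ENNReal.inv_pow]
  congr 1
  rw [← ofReal_norm, Padic.norm_p, ENNReal.ofReal_inv_of_pos (by exact_mod_cast hp.out.pos)]
  simp

/-- By uniqueness of Haar measure the pushforward is a multiple of `haar p`; the factor is found by
evaluating on the unit ball. -/
theorem haar_map_mul_eq {c : ℚ_[p]} (hc : c ≠ 0) :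
    (haar p).map (c * ·) = haar p (Metric.closedBall 0 ‖c‖⁻¹) • haar p := by
  have hh : ((haar p).map (c * ·)).IsAddHaarMeasure :=
    Measure.isAddHaarMeasure_map (haar p) (AddMonoidHom.mulLeft c) (continuous_const_mul c)
      (fun x => ⟨c⁻¹ * x, mul_inv_cancel_left₀ hc x⟩)
      (Homeomorph.mulLeft₀ c hc).isClosedEmbedding.tendsto_cocompact
  obtain ⟨κ, h⟩ : ∃ κ : NNReal, (haar p).map (c * ·) = κ • haar p :=
    ⟨_, Measure.isAddLeftInvariant_eq_smul ((haar p).map (c * ·)) (haar p)⟩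
  have h2 := congrArg (fun μ => μ (Metric.closedBall (0 : ℚ_[p]) 1)) h
  simp only [Measure.smul_apply, haar_closedBall_zero_one] at h2
  rw [Measure.map_apply (measurable_const_mul c) Metric.isClosed_closedBall.measurableSet] at h2
  have h3 : (c * ·) ⁻¹' Metric.closedBall (0 : ℚ_[p]) 1 = Metric.closedBall 0 ‖c‖⁻¹ := by
    ext x
    simp only [Set.mem_preimage, mem_closedBall_zero_iff, norm_mul]
    rw [← one_div, le_div_iff₀' (norm_pos_iff.2 hc)]
  rw [h3] at h2
  rw [h2, smul_assoc, one_smul]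
  exact h

theorem haar_closedBall_norm (a : ℚ_[p]) {c : ℚ_[p]} (hc : c ≠ 0) :
    haar p (Metric.closedBall a ‖c‖) = ‖c‖ₑ := by
  rw [haar_closedBall_eq]
  have hp0 : (p : ℚ_[p]) ≠ 0 := by exact_mod_cast hp.out.ne_zero
  have key (r : ℕ) : haar p (Metric.closedBall 0 ‖(p : ℚ_[p]) ^ r‖) = ‖(p : ℚ_[p]) ^ r‖ₑ := by
    rw [enorm_pow_neg, ← haar_closedBall_pow_neg 0 r]
    congr 2
    simp
  -- Radii above `1` come from the scaling formula evaluated on the ball of radius `‖p ^ r‖`, whose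
  -- preimage under multiplication by `p ^ r` is the unit ball.
  have key2 (r : ℕ) : haar p (Metric.closedBall 0 ‖(p : ℚ_[p]) ^ r‖⁻¹) = ‖(p : ℚ_[p]) ^ r‖ₑ⁻¹ := by
    have h0 : (p : ℚ_[p]) ^ r ≠ 0 := pow_ne_zero _ hp0
    have h := congrArg (fun μ => μ (Metric.closedBall (0 : ℚ_[p]) ‖(p : ℚ_[p]) ^ r‖))
      (haar_map_mul_eq h0)
    simp only [Measure.smul_apply, key, smul_eq_mul] at h
    rw [Measure.map_apply (measurable_const_mul _) Metric.isClosed_closedBall.measurableSet] at h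
    have h3 : ((p : ℚ_[p]) ^ r * ·) ⁻¹' Metric.closedBall (0 : ℚ_[p]) ‖(p : ℚ_[p]) ^ r‖ =
        Metric.closedBall 0 1 := by
      ext x
      simp only [Set.mem_preimage, mem_closedBall_zero_iff, norm_mul]
      rw [mul_le_iff_le_one_right (norm_pos_iff.2 h0)]
    rw [h3, haar_closedBall_zero_one] at h
    exact ENNReal.eq_inv_of_mul_eq_one_left h.symm
  have hk := Padic.norm_eq_zpow_neg_valuation hc
  obtain ⟨r, hr | hr⟩ := Int.eq_nat_or_neg c.valuation
  · have h : ‖c‖ = ‖(p : ℚ_[p]) ^ r‖ := by rw [hk, hr, Padic.norm_p_pow]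
    rw [← ofReal_norm, h, ofReal_norm, key]
  · have h : ‖c‖ = ‖(p : ℚ_[p]) ^ r‖⁻¹ := by
      rw [hk, hr, Padic.norm_p_pow, neg_neg, ← zpow_neg, neg_neg]
    rw [← ofReal_norm, h, key2, ENNReal.ofReal_inv_of_pos, ofReal_norm]
    exact norm_pos_iff.2 (pow_ne_zero _ hp0)

theorem haar_map_mul {c : ℚ_[p]} (hc : c ≠ 0) : (haar p).map (c * ·) = ‖c‖ₑ⁻¹ • haar p := by
  rw [haar_map_mul_eq hc, ← norm_inv, haar_closedBall_norm _ (inv_ne_zero hc), enorm_inv hc]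

theorem haar_preimage_mul {c : ℚ_[p]} (hc : c ≠ 0) {s : Set ℚ_[p]} (hs : MeasurableSet s) :
    haar p ((c * ·) ⁻¹' s) = ‖c‖ₑ⁻¹ * haar p s := by
  rw [← Measure.map_apply (measurable_const_mul c) hs, haar_map_mul hc]
  rfl

theorem haar_setOf_norm_eq_one : haar p {x | ‖x‖ = 1} = ENNReal.ofReal (1 - 1 / p) := by
  have h : {x : ℚ_[p] | ‖x‖ = 1} = Metric.closedBall 0 1 \ Metric.closedBall 0 (p ^ (-1 : ℤ)) := by
    ext x
    simp only [Set.mem_ofPred_eq, Set.mem_sdiff, mem_closedBall_zero_iff, not_le]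
    -- The value group is discrete: norm below `1` means norm at most `p⁻¹`.
    have h1 := Padic.norm_le_pow_iff_norm_lt_pow_add_one x (-1)
    simp only [neg_add_cancel, zpow_zero] at h1
    rw [← not_le, h1, not_lt]
    exact ⟨fun h => ⟨h.le, h.ge⟩, fun h => le_antisymm h.1 h.2⟩
  have h1 := haar_closedBall_pow_neg (0 : ℚ_[p]) 1
  simp only [Nat.cast_one, pow_one] at h1
  have hp1 : (1 : ℝ) < p := by exact_mod_cast hp.out.one_lt
  rw [h, measure_sdiff, haar_closedBall_zero_one, h1, one_div, ENNReal.ofReal_sub,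
    ENNReal.ofReal_inv_of_pos (by linarith)]
  · simp
  · positivity
  · exact Metric.closedBall_subset_closedBall (pow_neg_le_one 1)
  · exact Metric.isClosed_closedBall.measurableSet.nullMeasurableSet
  · rw [h1]; simp [hp.out.ne_zero]

theorem pi_haar_map_mul {ι : Type*} [Fintype ι] (c : ι → ℚ_[p]) (hc : ∀ i, c i ≠ 0) :
    (Measure.pi fun _ : ι => haar p).map (fun u i => c i * u i) =
      (∏ i, ‖c i‖ₑ⁻¹) • Measure.pi fun _ : ι => haar p := by
  have hm : Measurable fun (u : ι → ℚ_[p]) i => c i * u i := by fun_prop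
  have h0 : ∏ i, ‖c i‖ₑ ≠ 0 := Finset.prod_ne_zero_iff.2 fun i _ => by simpa using hc i
  have h1 : ∏ i, ‖c i‖ₑ ≠ ∞ := ENNReal.prod_ne_top fun i _ => enorm_ne_top
  have h2 : ∏ i, ‖c i‖ₑ⁻¹ = (∏ i, ‖c i‖ₑ)⁻¹ :=
    (ENNReal.prod_inv_distrib fun i _ j _ _ => Or.inr (by simp)).symm
  -- `Measure.pi_eq` recognises a product measure from its values on boxes, so the factor is first
  -- moved to the side of the pushforward and inverted afterwards.
  have : Measure.pi (fun _ : ι => haar p) =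
      (∏ i, ‖c i‖ₑ) • (Measure.pi fun _ : ι => haar p).map (fun u i => c i * u i) := by
    refine Measure.pi_eq fun s hs => ?_
    rw [Measure.smul_apply, Measure.map_apply hm (MeasurableSet.univ_pi hs)]
    have : (fun (u : ι → ℚ_[p]) i => c i * u i) ⁻¹' Set.univ.pi s =
        Set.univ.pi fun i => (c i * ·) ⁻¹' s i := by
      ext; simp
    rw [this, Measure.pi_pi, smul_eq_mul, ← Finset.prod_mul_distrib]
    refine Finset.prod_congr rfl fun i _ => ?_
    rw [haar_preimage_mul (hc i) (hs i), ← mul_assoc,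
      ENNReal.mul_inv_cancel (by simpa using hc i) enorm_ne_top, one_mul]
  conv_rhs => rw [this]
  rw [smul_smul, h2, ENNReal.inv_mul_cancel h0 h1, one_smul]

/-- Insert the coordinate `s` at the index `m`. -/
noncomputable def insertAt {ι : Type*} [DecidableEq ι] (m : ι)
    (u : ({l : ι // l ≠ m} → ℚ_[p]) × ℚ_[p]) : ι → ℚ_[p] :=
  fun l => if h : l ≠ m then u.1 ⟨l, h⟩ else u.2

theorem measurable_insertAt {ι : Type*} [DecidableEq ι] (m : ι) :
    Measurable (insertAt (p := p) m) := by
  refine measurable_pi_lambda _ fun l => ?_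
  unfold insertAt
  split_ifs <;> fun_prop

theorem map_insertAt {ι : Type*} [Fintype ι] [DecidableEq ι] (m : ι) :
    ((Measure.pi fun _ : {l : ι // l ≠ m} => haar p).prod (haar p)).map (insertAt m) =
      Measure.pi fun _ : ι => haar p := by
  refine (Measure.pi_eq fun s hs => ?_).symm
  rw [Measure.map_apply (measurable_insertAt m) (MeasurableSet.univ_pi hs)]
  have : insertAt (p := p) m ⁻¹' Set.univ.pi s =
      (Set.univ.pi fun l : {l : ι // l ≠ m} => s l) ×ˢ s m := by
    ext u
    simp only [Set.mem_preimage, Set.mem_pi, Set.mem_univ, true_imp_iff, Set.mem_prod,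
      Subtype.forall, insertAt]
    constructor
    · intro h
      exact ⟨fun l hl => by simpa [hl] using h l, by simpa using h m⟩
    · intro h l
      split_ifs with hl
      · exact h.1 l hl
      · rw [not_not.1 hl]; exact h.2
  rw [this, Measure.prod_prod, Measure.pi_pi, ← Fintype.prod_subtype_mul_prod_subtype (· ≠ m)]
  congr 1
  have : Unique {l // ¬ l ≠ m} := ⟨⟨⟨m, by simp⟩⟩, fun l => Subtype.ext (not_not.1 l.2)⟩
  rw [Fintype.prod_unique]
  rw [not_not.1 (default : {l // ¬ l ≠ m}).2]

end Haar

/-! ### Charts of the cone, and volumes of tubes around it. -/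

section Chart

variable {n : ℕ} (α : Fin (n + 1) → Fin (n + 1) → Fin (n + 1) → ℤ) {p : ℕ} [hp : Fact p.Prime]

theorem natCast_prime_ne_zero : (p : ℚ_[p]) ≠ 0 := by exact_mod_cast hp.out.ne_zero

theorem continuous_F : Continuous (F α : (Coord n → ℚ_[p]) → ℚ_[p]) := by
  refine Continuous.congr ?_ fun t => (F_eq_sum α t).symm
  fun_prop

theorem continuous_dF (m : Coord n) : Continuous (dF α m : (Coord n → ℚ_[p]) → ℚ_[p]) := by
  refine Continuous.congr ?_ fun t => (dF_eq_sum α m t).symm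
  fun_prop

theorem insertAt_eq_update (m : Coord n) (u : {l : Coord n // l ≠ m} → ℚ_[p]) (x : ℚ_[p]) :
    insertAt m (u, x) = Function.update (insertAt m (u, 0)) m x := by
  ext l
  by_cases h : l = m
  · subst h; simp [insertAt]
  · simp [insertAt, h]

theorem F_insertAt (m : Coord n) (u : {l : Coord n // l ≠ m} → ℚ_[p]) (x : ℚ_[p]) :
    F α (insertAt m (u, x)) = x * dF α m (insertAt m (u, 0)) + F α (insertAt m (u, 0)) := by
  rw [insertAt_eq_update, F_update, ← insertAt_eq_update]

theorem dF_insertAt (m : Coord n) (u : {l : Coord n // l ≠ m} → ℚ_[p]) (x : ℚ_[p]) :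
    dF α m (insertAt m (u, x)) = dF α m (insertAt m (u, 0)) := by
  rw [insertAt_eq_update, dF_update]

/-- Presents the cone point as the centre of the ball met in the Fubini argument along `t_m`; the
placeholder `0` is harmless because `∂F/∂t_m` does not involve `t_m`. -/
theorem conePoint_eq (m : Coord n) (u : {l : Coord n // l ≠ m} → ℚ_[p]) :
    conePoint α m u =
      insertAt m (u, -F α (insertAt m (u, 0)) / dF α m (insertAt m (u, 0))) := by
  rw [insertAt_eq_update, conePoint, solve]
  change Function.update (insertAt m (u, 0)) m
    (-F α (Function.update (insertAt m (u, 0)) m 0) / dF α m (insertAt m (u, 0))) = _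
  rw [← insertAt_eq_update, ← insertAt_eq_update, ← insertAt_eq_update]

theorem dF_conePoint (m : Coord n) (u : {l : Coord n // l ≠ m} → ℚ_[p]) :
    dF α m (conePoint α m u) = dF α m (insertAt m (u, 0)) := by
  rw [conePoint_eq, dF_insertAt]

theorem F_conePoint (m : Coord n) (u : {l : Coord n // l ≠ m} → ℚ_[p])
    (h : dF α m (conePoint α m u) ≠ 0) : F α (conePoint α m u) = 0 := by
  rw [dF_conePoint] at h
  rw [conePoint_eq, F_insertAt, div_mul_cancel₀ _ h, neg_add_cancel]

theorem conePoint_apply_of_ne (m : Coord n) (u : {l : Coord n // l ≠ m} → ℚ_[p]) (l : Coord n)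
    (h : l ≠ m) : conePoint α m u l = u ⟨l, h⟩ := by
  rw [conePoint_eq, insertAt, dif_pos h]

theorem measurable_conePoint (m : Coord n) :
    Measurable (conePoint α m : ({l : Coord n // l ≠ m} → ℚ_[p]) → _) := by
  rw [funext fun u => conePoint_eq α m u]
  have h : Measurable fun u : {l : Coord n // l ≠ m} → ℚ_[p] => insertAt m (u, (0 : ℚ_[p])) :=
    (measurable_insertAt m).comp (by fun_prop)
  have h1 := (continuous_F (p := p) α).measurable.comp h
  have h2 := (continuous_dF (p := p) α m).measurable.comp h
  exact (measurable_insertAt m).comp (measurable_id.prodMk (h1.neg.div h2))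

variable (p) in
/-- The measure `|∂F/∂t_m|⁻¹ ∏_{l ≠ m} dt_l` on the whole chart `∂F/∂t_m ≠ 0` of the cone. -/
noncomputable def lam (m : Coord n) : Measure (Coord n → ℚ_[p]) :=
  (((Measure.pi fun _ : {l : Coord n // l ≠ m} => haar p).restrict
      {u | dF α m (conePoint α m u) ≠ 0}).withDensity
    fun u => (‖dF α m (conePoint α m u)‖ₑ)⁻¹).map (conePoint α m)

theorem measurable_dF_conePoint (l m : Coord n) :
    Measurable fun u : {l : Coord n // l ≠ m} → ℚ_[p] => dF α l (conePoint α m u) :=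
  (continuous_dF α l).measurable.comp (measurable_conePoint α m)

theorem lam_apply (m : Coord n) {B : Set (Coord n → ℚ_[p])} (hB : MeasurableSet B) :
    lam α p m B = ∫⁻ u : {l : Coord n // l ≠ m} → ℚ_[p] in
      {u | dF α m (conePoint α m u) ≠ 0 ∧ conePoint α m u ∈ B},
        (‖dF α m (conePoint α m u)‖ₑ)⁻¹ ∂(Measure.pi fun _ => haar p) := by
  have h1 := measurable_conePoint α m hB
  rw [lam, Measure.map_apply (measurable_conePoint α m) hB, withDensity_apply _ h1,
    Measure.restrict_restrict h1, Set.inter_comm]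
  rfl

variable (n p) in
/-- The Haar measure on `ℚ_p^{3n+3}`. -/
noncomputable abbrev vol : Measure (Coord n → ℚ_[p]) := Measure.pi fun _ => haar p

variable (p) in
/-- The set of points with `|F| ≤ p⁻ʳ`. -/
def tube (r : ℕ) : Set (Coord n → ℚ_[p]) := {t | ‖F α t‖ ≤ ‖(p : ℚ_[p]) ^ r‖}

theorem isClosed_tube (r : ℕ) : IsClosed (tube α p r) :=
  isClosed_le (continuous_F α).norm continuous_const

theorem dist_insertAt_le (m : Coord n) (u : {l : Coord n // l ≠ m} → ℚ_[p]) (x y : ℚ_[p]) :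
    dist (insertAt m (u, x)) (insertAt m (u, y)) ≤ ‖x - y‖ := by
  refine (dist_pi_le_iff (norm_nonneg _)).2 fun l => ?_
  by_cases h : l = m
  · subst h; simp [insertAt, dist_eq_norm]
  · simp [insertAt, h]

theorem setOf_norm_le_eq_closedBall {a b : ℚ_[p]} (hb : b ≠ 0) (c : ℚ_[p]) :
    {x | ‖x * b + a‖ ≤ ‖c‖} = Metric.closedBall (-a / b) ‖c / b‖ := by
  ext x
  rw [Set.mem_ofPred_eq, mem_closedBall_iff_norm, norm_div, le_div_iff₀ (norm_pos_iff.2 hb),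
    ← norm_mul, sub_mul, div_mul_cancel₀ _ hb, sub_neg_eq_add]

theorem tendsto_norm_prime_pow : Tendsto (fun r : ℕ => ‖(p : ℚ_[p]) ^ r‖) atTop (𝓝 0) := by
  simp only [norm_pow]
  exact tendsto_pow_atTop_nhds_zero_of_lt_one (norm_nonneg _) Padic.norm_p_lt_one

theorem norm_prime_pow_antitone {r s : ℕ} (h : r ≤ s) :
    ‖(p : ℚ_[p]) ^ s‖ ≤ ‖(p : ℚ_[p]) ^ r‖ := by
  rw [norm_pow, norm_pow]
  exact pow_le_pow_of_le_one (norm_nonneg _) Padic.norm_p_lt_one.le h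

theorem exists_forall_le_norm {X : Type*} [TopologicalSpace X] {E : Type*} [NormedAddGroup E]
    {D : Set X} (hc : IsCompact D) {f : X → E} (hf : Continuous f) (h : ∀ t ∈ D, f t ≠ 0) :
    ∃ ε > 0, ∀ t ∈ D, ε ≤ ‖f t‖ := by
  rcases D.eq_empty_or_nonempty with rfl | hne
  · exact ⟨1, one_pos, by simp⟩
  · obtain ⟨x, hx, hmin⟩ := hc.exists_isMinOn hne hf.norm.continuousOn
    exact ⟨‖f x‖, norm_pos_iff.2 (h x hx), fun t ht => hmin ht⟩

/-- Fubini in the direction `t_m`: the tube meets each line in a ball centred at the cone point, of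
volume `p⁻ʳ / |∂F/∂t_m|`. Once these balls are uniformly small, each lies wholly inside or wholly
outside `D`, so the equality is exact and not only asymptotic. -/
theorem exists_vol_inter_tube_eq_lam (m : Coord n) {D : Set (Coord n → ℚ_[p])}
    (hc : IsCompact D) (ho : IsOpen D) (hD : ∀ t ∈ D, dF α m t ≠ 0) :
    ∃ R, ∀ r ≥ R, (p : ℝ≥0∞) ^ r * vol n p (D ∩ tube α p r) = lam α p m D := by
  -- `ε` bounds `|∂F/∂t_m|` below on `D`, `δ` is a distance one can move from `D` without leaving
  -- it, and `R` makes the radius bound `|p ^ r| / ε` smaller than `δ`.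
  obtain ⟨ε, hε, hmin⟩ := exists_forall_le_norm hc (continuous_dF α m) hD
  obtain ⟨δ, hδ, hth⟩ := hc.exists_thickening_subset_open ho subset_rfl
  obtain ⟨R, hR⟩ := (((tendsto_norm_prime_pow (p := p)).div_const ε).eventually_lt_const
    (by simpa using hδ)).exists_forall_of_atTop
  refine ⟨R, fun r hr => ?_⟩
  have hlt := hR r hr
  have hmeas : MeasurableSet (D ∩ tube α p r) :=
    ho.measurableSet.inter (isClosed_tube α r).measurableSet
  have hU : MeasurableSet {u : {l : Coord n // l ≠ m} → ℚ_[p] |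
      dF α m (conePoint α m u) ≠ 0 ∧ conePoint α m u ∈ D} :=
    ((measurable_dF_conePoint α m m) (measurableSet_singleton 0).compl).inter
      (measurable_conePoint α m ho.measurableSet)
  rw [vol, ← map_insertAt m, Measure.map_apply (measurable_insertAt m) hmeas,
    Measure.prod_apply (measurable_insertAt m hmeas), lam_apply α m ho.measurableSet,
    ← lintegral_indicator hU, ← lintegral_const_mul' _ _ (by simp)]
  refine lintegral_congr fun u => ?_
  -- On one line, a tube point and the cone point are less than `δ` apart. The bound by `ε` holds as
  -- soon as either is in `D`, since the derivative is constant along the line.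
  have key : ∀ x, dF α m (insertAt m (u, 0)) ≠ 0 → (insertAt m (u, x) ∈ D ∨ conePoint α m u ∈ D) →
      ‖F α (insertAt m (u, x))‖ ≤ ‖(p : ℚ_[p]) ^ r‖ →
      (insertAt m (u, x) ∈ D ∧ conePoint α m u ∈ D) := by
    intro x hb hx hF
    have hbε : ε ≤ ‖dF α m (insertAt m (u, 0))‖ := by
      rcases hx with hx | hx
      · rw [← dF_insertAt α m u x]; exact hmin _ hx
      · rw [← dF_conePoint]; exact hmin _ hx
    have hd : dist (insertAt m (u, x)) (conePoint α m u) < δ := by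
      rw [conePoint_eq]
      refine (dist_insertAt_le _ _ _ _).trans_lt (lt_of_le_of_lt ?_ hlt)
      rw [F_insertAt] at hF
      have h1 := (Set.ext_iff.1 (setOf_norm_le_eq_closedBall (a := F α (insertAt m (u, 0)))
        hb ((p : ℚ_[p]) ^ r)) x).1 hF
      rw [mem_closedBall_iff_norm] at h1
      refine h1.trans ?_
      rw [norm_div]
      exact div_le_div_of_nonneg_left (norm_nonneg _) hε hbε
    rcases hx with hx | hx
    · exact ⟨hx, hth (Metric.mem_thickening_iff.2 ⟨_, hx, by rwa [dist_comm]⟩)⟩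
    · exact ⟨hth (Metric.mem_thickening_iff.2 ⟨_, hx, hd⟩), hx⟩
  by_cases hu : dF α m (conePoint α m u) ≠ 0 ∧ conePoint α m u ∈ D
  · rw [Set.indicator_of_mem
      (show u ∈ {u | dF α m (conePoint α m u) ≠ 0 ∧ conePoint α m u ∈ D} from hu)]
    have hb := hu.1
    rw [dF_conePoint] at hb
    have : Prod.mk u ⁻¹' (insertAt m ⁻¹' (D ∩ tube α p r)) =
        Metric.closedBall (-F α (insertAt m (u, 0)) / dF α m (insertAt m (u, 0)))
          ‖(p : ℚ_[p]) ^ r / dF α m (insertAt m (u, 0))‖ := by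
      rw [← setOf_norm_le_eq_closedBall hb]
      ext x
      simp only [Set.mem_preimage, Set.mem_inter_iff, tube, Set.mem_ofPred_eq]
      rw [← F_insertAt]
      exact ⟨fun h => h.2, fun h => ⟨(key x hb (Or.inr hu.2) h).1, h⟩⟩
    rw [this, haar_closedBall_norm _ (div_ne_zero (pow_ne_zero _ natCast_prime_ne_zero) hb),
      div_eq_mul_inv, enorm_mul, enorm_pow_neg, enorm_inv hb, ← mul_assoc,
      ENNReal.mul_inv_cancel (by simp [hp.out.ne_zero]) (by simp), one_mul, dF_conePoint]
  · rw [Set.indicator_of_notMem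
      (show u ∉ {u | dF α m (conePoint α m u) ≠ 0 ∧ conePoint α m u ∈ D} from hu)]
    have : Prod.mk u ⁻¹' (insertAt m ⁻¹' (D ∩ tube α p r)) = ∅ := by
      ext x
      simp only [Set.mem_preimage, Set.mem_inter_iff, Set.mem_empty_iff_false, iff_false]
      rintro ⟨hx, hF⟩
      have hb : dF α m (insertAt m (u, 0)) ≠ 0 := by
        rw [← dF_insertAt α m u x]; exact hD _ hx
      exact hu ⟨by rwa [dF_conePoint], (key x hb (Or.inl hx) hF).2⟩
    rw [this, measure_empty, mul_zero]

end Chart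

/-! ### Gluing the chart measures into the Leray measure. -/

section Leray

variable {n : ℕ} (α : Fin (n + 1) → Fin (n + 1) → Fin (n + 1) → ℤ) {p : ℕ} [hp : Fact p.Prime]

theorem isClopen_setOf_le_norm {X : Type*} [TopologicalSpace X] {f : X → ℚ_[p]}
    (hf : Continuous f) (ε : ℝ) : IsClopen {t | ε ≤ ‖f t‖} := by
  have h := ((IsUltrametricDist.isClopen_ball (0 : ℚ_[p]) ε).preimage hf).compl
  convert h using 1
  ext; simp

/-- Both sides are the stable value of the same normalised volume, which replaces a Jacobian
computation between charts. -/
theorem lam_eq_lam_of_isCompact {m l : Coord n} {D : Set (Coord n → ℚ_[p])}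
    (hc : IsCompact D) (ho : IsOpen D) (hm : ∀ t ∈ D, dF α m t ≠ 0)
    (hl : ∀ t ∈ D, dF α l t ≠ 0) : lam α p m D = lam α p l D := by
  obtain ⟨R, hR⟩ := exists_vol_inter_tube_eq_lam α m hc ho hm
  obtain ⟨S, hS⟩ := exists_vol_inter_tube_eq_lam α l hc ho hl
  rw [← hR (max R S) (le_max_left _ _), hS (max R S) (le_max_right _ _)]

theorem vol_ne_top_of_isCompact {D : Set (Coord n → ℚ_[p])} (hc : IsCompact D) :
    vol n p D ≠ ∞ := hc.measure_lt_top.ne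

theorem lam_ne_top_of_isCompact {m : Coord n} {D : Set (Coord n → ℚ_[p])}
    (hc : IsCompact D) (ho : IsOpen D) (hm : ∀ t ∈ D, dF α m t ≠ 0) : lam α p m D ≠ ∞ := by
  obtain ⟨R, hR⟩ := exists_vol_inter_tube_eq_lam α m hc ho hm
  rw [← hR R le_rfl]
  exact ENNReal.mul_ne_top (by simp)
    (measure_ne_top_of_subset Set.inter_subset_left (vol_ne_top_of_isCompact hc))

theorem borel_eq_generateFrom_isClopen {X : Type*} [TopologicalSpace X]
    [SecondCountableTopology X] [LocallyCompactSpace X] [T2Space X] [TotallyDisconnectedSpace X] :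
    borel X = MeasurableSpace.generateFrom {s | IsClopen s} :=
  (loc_compact_Haus_tot_disc_of_zero_dim (H := X)).borel_eq_generateFrom

/-- The points of size at most `pᵏ` where two partial derivatives have size at least `p⁻ᵏ`. -/
def biChart (p : ℕ) [Fact p.Prime] (m l : Coord n) (k : ℕ) : Set (Coord n → ℚ_[p]) :=
  Metric.closedBall 0 (k + 1) ∩
    ({t | ‖(p : ℚ_[p]) ^ k‖ ≤ ‖dF α m t‖} ∩ {t | ‖(p : ℚ_[p]) ^ k‖ ≤ ‖dF α l t‖})

theorem isOpen_biChart (m l : Coord n) (k : ℕ) : IsOpen (biChart α p m l k) :=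
  (IsUltrametricDist.isOpen_closedBall _ (by positivity)).inter
    ((isClopen_setOf_le_norm (continuous_dF α m) _).isOpen.inter
      (isClopen_setOf_le_norm (continuous_dF α l) _).isOpen)

theorem isCompact_biChart (m l : Coord n) (k : ℕ) : IsCompact (biChart α p m l k) :=
  (isCompact_closedBall _ _).inter_right
    ((isClopen_setOf_le_norm (continuous_dF α m) _).isClosed.inter
      (isClopen_setOf_le_norm (continuous_dF α l) _).isClosed)

theorem monotone_biChart (m l : Coord n) : Monotone (biChart α p m l) := by
  intro k k' h t ht
  refine ⟨Metric.closedBall_subset_closedBall (by gcongr) ht.1, ?_, ?_⟩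
  · exact (norm_prime_pow_antitone h).trans ht.2.1
  · exact (norm_prime_pow_antitone h).trans ht.2.2

theorem biChart_subset {m l : Coord n} {k : ℕ} {t : Coord n → ℚ_[p]} (ht : t ∈ biChart α p m l k) :
    dF α m t ≠ 0 ∧ dF α l t ≠ 0 := by
  have h0 : 0 < ‖(p : ℚ_[p]) ^ k‖ := norm_pos_iff.2 (pow_ne_zero _ natCast_prime_ne_zero)
  exact ⟨norm_pos_iff.1 (h0.trans_le ht.2.1), norm_pos_iff.1 (h0.trans_le ht.2.2)⟩

theorem exists_mem_biChart {m l : Coord n} {t : Coord n → ℚ_[p]} (hm : dF α m t ≠ 0)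
    (hl : dF α l t ≠ 0) : ∃ k, t ∈ biChart α p m l k := by
  have h1 := (tendsto_norm_prime_pow (p := p)).eventually_le_const (norm_pos_iff.2 hm)
  have h2 := (tendsto_norm_prime_pow (p := p)).eventually_le_const (norm_pos_iff.2 hl)
  have h3 : ∀ᶠ k : ℕ in atTop, ‖t‖ ≤ k :=
    (tendsto_natCast_atTop_atTop (R := ℝ)).eventually_ge_atTop _
  obtain ⟨k, h1, h2, h3⟩ := (h1.and (h2.and h3)).exists
  exact ⟨k, by simpa using h3.trans (by linarith), h1, h2⟩

/-- The two measures agree on clopen sets, a π-system generating the Borel sets; compactness of the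
piece supplies the finiteness needed for uniqueness. -/
theorem lam_restrict_biChart (m l : Coord n) (k : ℕ) :
    (lam α p m).restrict (biChart α p m l k) = (lam α p l).restrict (biChart α p m l k) := by
  have hc := isCompact_biChart α (p := p) m l k
  have ho := isOpen_biChart α (p := p) m l k
  have hfin : IsFiniteMeasure ((lam α p m).restrict (biChart α p m l k)) :=
    isFiniteMeasure_restrict.2 (lam_ne_top_of_isCompact α hc ho fun t ht => (biChart_subset α ht).1)
  have key (s : Set (Coord n → ℚ_[p])) (hs : IsClopen s) :
      (lam α p m).restrict (biChart α p m l k) s = (lam α p l).restrict (biChart α p m l k) s := by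
    rw [Measure.restrict_apply hs.isOpen.measurableSet,
      Measure.restrict_apply hs.isOpen.measurableSet]
    exact lam_eq_lam_of_isCompact α (hc.inter_left hs.isClosed) (hs.isOpen.inter ho)
      (fun t ht => (biChart_subset α ht.2).1) (fun t ht => (biChart_subset α ht.2).2)
  refine ext_of_generate_finite {s | IsClopen s} ?_ ?_ key (key _ isClopen_univ)
  · rw [← borel_eq_generateFrom_isClopen]
    exact BorelSpace.measurable_eq
  · exact fun s hs t ht _ => IsClopen.inter hs ht

theorem lam_eq_lam {m l : Coord n} {B : Set (Coord n → ℚ_[p])} (hB : MeasurableSet B)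
    (hm : ∀ t ∈ B, dF α m t ≠ 0) (hl : ∀ t ∈ B, dF α l t ≠ 0) : lam α p m B = lam α p l B := by
  have h : B = ⋃ k, B ∩ biChart α p m l k := by
    rw [← Set.inter_iUnion]
    refine (Set.inter_eq_left.2 fun t ht => Set.mem_iUnion.2 ?_).symm
    exact exists_mem_biChart α (hm t ht) (hl t ht)
  have hmono : Monotone fun k => B ∩ biChart α p m l k :=
    fun k k' hk => Set.inter_subset_inter_right _ (monotone_biChart α m l hk)
  rw [h, hmono.measure_iUnion, hmono.measure_iUnion]
  refine iSup_congr fun k => ?_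
  rw [← Measure.restrict_apply hB, lam_restrict_biChart, Measure.restrict_apply hB]

/-- The points where `m` is the first index satisfying a condition `P`. -/
def firstAt {X : Type*} (P : Coord n → X → Prop) (m : Coord n) : Set X :=
  {t | P m t ∧ ∀ l : Coord n, toLex l < toLex m → ¬ P l t}

theorem exists_mem_firstAt {X : Type*} {P : Coord n → X → Prop} {t : X} (h : ∃ m, P m t) :
    ∃ m, t ∈ firstAt P m := by
  obtain ⟨m, hm, hmin⟩ := (wellFounded_lt (α := Fin 3 ×ₗ Fin (n + 1))).has_min
    {m | P (ofLex m) t} (h.imp fun m hm => hm)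
  exact ⟨ofLex m, hm, fun l hl hP => hmin (toLex l) hP hl⟩

theorem pairwise_disjoint_firstAt {X : Type*} (P : Coord n → X → Prop) :
    Pairwise (Function.onFun Disjoint (firstAt P)) := by
  intro m l hml
  refine Set.disjoint_left.2 fun t ht ht' => ?_
  rcases lt_trichotomy (toLex m) (toLex l) with h | h | h
  · exact ht'.2 m h ht.1
  · exact hml (toLex.injective h)
  · exact ht.2 l h ht'.1

theorem measure_eq_sum_inter_firstAt {X : Type*} [MeasurableSpace X] (μ : Measure X)
    {P : Coord n → X → Prop} (hP : ∀ m, MeasurableSet (firstAt P m)) {B : Set X}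
    (hB : MeasurableSet B) (h : μ (B ∩ {t | ∀ m, ¬ P m t}) = 0) :
    μ B = ∑ m, μ (B ∩ firstAt P m) := by
  have h1 : B = (⋃ m, B ∩ firstAt P m) ∪ (B ∩ {t | ∀ m, ¬ P m t}) := by
    ext t
    refine ⟨fun ht => ?_, ?_⟩
    · by_cases hex : ∃ m, P m t
      · obtain ⟨m, hm⟩ := exists_mem_firstAt hex
        exact Or.inl (Set.mem_iUnion.2 ⟨m, ht, hm⟩)
      · exact Or.inr ⟨ht, not_exists.1 hex⟩
    · rintro (ht | ht)
      · obtain ⟨m, hm⟩ := Set.mem_iUnion.1 ht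
        exact hm.1
      · exact ht.1
  have h2 : μ B = μ (⋃ m, B ∩ firstAt P m) := by
    refine le_antisymm ?_ (measure_mono (Set.iUnion_subset fun m => Set.inter_subset_left))
    conv_lhs => rw [h1]
    exact (measure_union_le _ _).trans (by rw [h, add_zero])
  rw [h2, measure_iUnion, tsum_fintype]
  · exact fun m l hml => (pairwise_disjoint_firstAt P hml).mono Set.inter_subset_right
      Set.inter_subset_right
  · exact fun m => hB.inter (hP m)

variable (p) in
/-- The points where `m` is the first index with `∂F/∂t_m ≠ 0`. -/
def firstChart (m : Coord n) : Set (Coord n → ℚ_[p]) := firstAt (fun m t => dF α m t ≠ 0) m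

theorem measurableSet_firstAt {X : Type*} [MeasurableSpace X] {P : Coord n → X → Prop}
    (hP : ∀ m, MeasurableSet {t | P m t}) (m : Coord n) : MeasurableSet (firstAt P m) := by
  have : firstAt P m = {t | P m t} ∩ ⋂ l : Coord n, ⋂ _ : toLex l < toLex m, {t | P l t}ᶜ := by
    ext t; simp [firstAt]
  rw [this]
  exact (hP m).inter (MeasurableSet.iInter fun l => MeasurableSet.iInter fun _ => (hP l).compl)

theorem measurableSet_dF_ne_zero (m : Coord n) :
    MeasurableSet {t : Coord n → ℚ_[p] | dF α m t ≠ 0} :=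
  (continuous_dF α m).measurable (measurableSet_singleton 0).compl

theorem measurableSet_firstChart (m : Coord n) : MeasurableSet (firstChart α p m) :=
  measurableSet_firstAt (measurableSet_dF_ne_zero α) m

theorem leray_eq_sum : leray α p = ∑ m, (lam α p m).restrict (firstChart α p m) := by
  refine Finset.sum_congr rfl fun m _ => ?_
  have h1 := measurable_conePoint α m (measurableSet_firstChart α (p := p) m)
  rw [lam, Measure.restrict_map (measurable_conePoint α m) (measurableSet_firstChart α m),
    restrict_withDensity h1, Measure.restrict_restrict h1]
  congr 3
  ext u
  simp only [Set.mem_ofPred_eq, Set.mem_inter_iff, Set.mem_preimage, firstChart, firstAt, not_not]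
  tauto

theorem leray_apply {B : Set (Coord n → ℚ_[p])} (hB : MeasurableSet B) :
    leray α p B = ∑ m, lam α p m (B ∩ firstChart α p m) := by
  rw [leray_eq_sum, Measure.finsetSum_apply]
  exact Finset.sum_congr rfl fun m _ => Measure.restrict_apply hB

theorem lam_eq_zero {m : Coord n} {B : Set (Coord n → ℚ_[p])} (hB : MeasurableSet B)
    (h : ∀ t ∈ B, dF α m t ≠ 0 → F α t ≠ 0) : lam α p m B = 0 := by
  rw [lam_apply α m hB]
  have : {u | dF α m (conePoint α m u) ≠ 0 ∧ conePoint α m u ∈ B} = ∅ := by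
    ext u
    simp only [Set.mem_ofPred_eq, Set.mem_empty_iff_false, iff_false]
    exact fun hu => h _ hu.2 hu.1 (F_conePoint α m u hu.1)
  rw [this, Measure.restrict_empty, lintegral_zero_measure]

/-- Independence of the gluing rule: wherever `∂F/∂t_m ≠ 0`, the chart `m` alone computes the Leray
measure. -/
theorem leray_eq_lam {m : Coord n} {B : Set (Coord n → ℚ_[p])} (hB : MeasurableSet B)
    (hm : ∀ t ∈ B, dF α m t ≠ 0) : leray α p B = lam α p m B := by
  rw [leray_apply α hB, measure_eq_sum_inter_firstAt (lam α p m) (measurableSet_firstChart α) hB]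
  · refine Finset.sum_congr rfl fun l _ => ?_
    exact lam_eq_lam α (hB.inter (measurableSet_firstChart α l)) (fun t ht => ht.2.1)
      (fun t ht => hm t ht.1)
  · convert measure_empty (μ := lam α p m)
    exact Set.eq_empty_of_forall_notMem fun t ht => ht.2 m (hm t ht.1)

theorem leray_eq_zero {B : Set (Coord n → ℚ_[p])} (hB : MeasurableSet B)
    (h : ∀ t ∈ B, F α t ≠ 0) : leray α p B = 0 := by
  rw [leray_apply α hB]
  exact Finset.sum_eq_zero fun m _ => lam_eq_zero α (hB.inter (measurableSet_firstChart α m))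
    fun t ht _ => h t ht.1

theorem isClopen_firstAt_le_norm (ε : ℝ) (m : Coord n) :
    IsClopen (firstAt (fun m (t : Coord n → ℚ_[p]) => ε ≤ ‖dF α m t‖) m) := by
  have : firstAt (fun m (t : Coord n → ℚ_[p]) => ε ≤ ‖dF α m t‖) m = {t | ε ≤ ‖dF α m t‖} ∩
      ⋂ l ∈ {l : Coord n | toLex l < toLex m}, {t | ε ≤ ‖dF α l t‖}ᶜ := by
    ext t; simp [firstAt]
  rw [this]
  have h (l : Coord n) := isClopen_setOf_le_norm (continuous_dF (p := p) α l) ε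
  exact (h m).inter ((Set.toFinite _).isClopen_biInter fun l _ => (h l).compl)

/-- By compactness `F` and its derivatives are never all small on `D`. Splitting by the first
derivative of size at least `ε`, rather than the first nonzero one, gives clopen pieces to which the
one-chart result applies. -/
theorem exists_vol_inter_tube_eq_leray {D : Set (Coord n → ℚ_[p])} (hc : IsCompact D)
    (ho : IsOpen D) (hD : ∀ t ∈ D, F α t = 0 → ∃ m, dF α m t ≠ 0) :
    ∃ R, ∀ r ≥ R, (p : ℝ≥0∞) ^ r * vol n p (D ∩ tube α p r) = leray α p D := by
  have hcont : Continuous fun t : Coord n → ℚ_[p] => (F α t, fun m => dF α m t) :=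
    (continuous_F α).prodMk (continuous_pi fun m => continuous_dF α m)
  obtain ⟨ε, hε, hmin⟩ := exists_forall_le_norm hc hcont fun t ht h => by
    obtain ⟨m, hm⟩ := hD t ht (congrArg Prod.fst h)
    exact hm (congrFun (congrArg Prod.snd h) m)
  -- The leftover piece stays away from the cone: it misses the tube for large `r` and has Leray
  -- measure zero.
  have hF : ∀ t ∈ D, (∀ m, ¬ ε ≤ ‖dF α m t‖) → ε ≤ ‖F α t‖ := by
    intro t ht h
    by_contra hlt
    refine (hmin t ht).not_gt ?_
    rw [Prod.norm_def]
    exact max_lt (not_le.1 hlt) ((pi_norm_lt_iff hε).2 fun m => not_le.1 (h m))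
  let P : Coord n → (Coord n → ℚ_[p]) → Prop := fun m t => ε ≤ ‖dF α m t‖
  have hcl (m : Coord n) : IsClopen (firstAt P m) := isClopen_firstAt_le_norm α ε m
  have hP (m : Coord n) : MeasurableSet (firstAt P m) := (hcl m).isOpen.measurableSet
  have hne (m : Coord n) : ∀ t ∈ D ∩ firstAt P m, dF α m t ≠ 0 :=
    fun t ht => norm_pos_iff.1 (hε.trans_le ht.2.1)
  choose R hR using fun m => exists_vol_inter_tube_eq_lam α m
    (hc.inter_right (hcl m).isClosed) (ho.inter (hcl m).isOpen) (hne m)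
  obtain ⟨R0, hR0⟩ := ((tendsto_norm_prime_pow (p := p)).eventually_lt_const
    hε).exists_forall_of_atTop
  refine ⟨max R0 (Finset.univ.sup R), fun r hr => ?_⟩
  have hnone : MeasurableSet (D ∩ {t | ∀ m, ¬ P m t}) := by
    refine ho.measurableSet.inter ?_
    simp only [Set.ofPred_forall]
    exact MeasurableSet.iInter fun m =>
      (isClopen_setOf_le_norm (continuous_dF α m) ε).compl.isOpen.measurableSet
  have h1 : ((vol n p).restrict (tube α p r)) D =
      ∑ m, ((vol n p).restrict (tube α p r)) (D ∩ firstAt P m) := by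
    refine measure_eq_sum_inter_firstAt _ hP ho.measurableSet ?_
    rw [Measure.restrict_apply hnone]
    convert measure_empty (μ := vol n p)
    refine Set.eq_empty_of_forall_notMem fun t ht => ?_
    exact ((hF t ht.1.1 ht.1.2).trans ht.2).not_gt (hR0 r ((le_max_left _ _).trans hr))
  have h2 : leray α p D = ∑ m, leray α p (D ∩ firstAt P m) := by
    refine measure_eq_sum_inter_firstAt _ hP ho.measurableSet (leray_eq_zero α hnone ?_)
    exact fun t ht => norm_pos_iff.1 (hε.trans_le (hF t ht.1 ht.2))
  rw [Measure.restrict_apply ho.measurableSet] at h1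
  rw [h1, h2, Finset.mul_sum]
  refine Finset.sum_congr rfl fun m _ => ?_
  rw [Measure.restrict_apply (ho.measurableSet.inter (hP m)), hR m r,
    leray_eq_lam α (ho.measurableSet.inter (hP m)) (hne m)]
  exact (Finset.le_sup (Finset.mem_univ m)).trans ((le_max_right _ _).trans hr)

end Leray

/-! ### Homogeneity of the volumes and of the Leray measure. -/

section Scaling

variable {n : ℕ} (α : Fin (n + 1) → Fin (n + 1) → Fin (n + 1) → ℤ) {p : ℕ} [hp : Fact p.Prime]

theorem vol_preimage_scale {c : Fin 3 → ℚ_[p]} (hc : ∀ s, c s ≠ 0) {X : Set (Coord n → ℚ_[p])}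
    (hX : MeasurableSet X) :
    vol n p (scale c ⁻¹' X) = ((∏ s, ‖c s‖ₑ) ^ (n + 1))⁻¹ * vol n p X := by
  have h := pi_haar_map_mul (fun l : Coord n => c l.1) fun l => hc l.1
  have h1 : (fun (u : Coord n → ℚ_[p]) i => c i.1 * u i) = scale c := rfl
  rw [h1] at h
  have hm : Measurable (scale c : (Coord n → ℚ_[p]) → _) := by
    rw [← h1]; fun_prop
  rw [vol, ← Measure.map_apply hm hX, h, Measure.smul_apply, smul_eq_mul]
  congr 1
  rw [← ENNReal.prod_inv_distrib fun i _ j _ _ => Or.inr (by simp), Fintype.prod_prod_type]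
  simp only [Finset.prod_const, Finset.card_univ, Fintype.card_fin]
  rw [Finset.prod_pow, ENNReal.inv_pow,
    ENNReal.prod_inv_distrib fun i _ j _ _ => Or.inr (by simp)]

variable (p) in
/-- The scaling factors `p ^ a s`. -/
noncomputable def powers (a : Fin 3 → ℕ) (s : Fin 3) : ℚ_[p] := (p : ℚ_[p]) ^ a s

theorem powers_ne_zero (a : Fin 3 → ℕ) (s : Fin 3) : powers p a s ≠ 0 :=
  pow_ne_zero _ natCast_prime_ne_zero

theorem prod_powers (a : Fin 3 → ℕ) : ∏ s, powers p a s = (p : ℚ_[p]) ^ ∑ s, a s :=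
  Finset.prod_pow_eq_pow_sum _ _ _

theorem preimage_scale_tube (a : Fin 3 → ℕ) (r : ℕ) :
    scale (powers p a) ⁻¹' tube α p (r + ∑ s, a s) = tube α p r := by
  ext t
  rw [Set.mem_preimage, tube, tube, Set.mem_ofPred_eq, Set.mem_ofPred_eq, F_scale, prod_powers,
    pow_add, mul_comm, norm_mul, norm_mul]
  exact mul_le_mul_iff_left₀ (norm_pos_iff.2 (pow_ne_zero _ natCast_prime_ne_zero))

/-- With `j = ∑ s, a s`, scaling contributes `p ^ (-(n+1)j)` to the volume, and the shift of level
by `j` contributes `p ^ j`. -/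
theorem pow_mul_vol_inter_tube_scale (a : Fin 3 → ℕ) (r : ℕ) {X : Set (Coord n → ℚ_[p])}
    (hX : MeasurableSet X) :
    (p : ℝ≥0∞) ^ (r + ∑ s, a s) * vol n p (X ∩ tube α p (r + ∑ s, a s)) =
      ((p : ℝ≥0∞) ^ n)⁻¹ ^ (∑ s, a s) *
        ((p : ℝ≥0∞) ^ r * vol n p (scale (powers p a) ⁻¹' X ∩ tube α p r)) := by
  have hp0 : (p : ℝ≥0∞) ≠ 0 := by simp [hp.out.ne_zero]
  have hpt : (p : ℝ≥0∞) ≠ ∞ := by simp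
  rw [← preimage_scale_tube α a r, ← Set.preimage_inter,
    vol_preimage_scale (powers_ne_zero a) (hX.inter (isClosed_tube α _).measurableSet)]
  have h : ∏ s, ‖powers p a s‖ₑ = ((p : ℝ≥0∞) ^ ∑ s, a s)⁻¹ := by
    rw [← enorm_pow_neg, ← prod_powers]
    simp [Fin.prod_univ_three, enorm_mul]
  rw [h]
  generalize ∑ s, a s = j
  have h1 : (((p : ℝ≥0∞) ^ j)⁻¹ ^ (n + 1))⁻¹ = (p : ℝ≥0∞) ^ (n * j) * (p : ℝ≥0∞) ^ j := by
    rw [ENNReal.inv_pow, inv_inv, ← pow_mul, ← pow_add]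
    congr 1; ring
  rw [h1, ENNReal.inv_pow, ← pow_mul, pow_add]
  have h2 := ENNReal.inv_mul_cancel (pow_ne_zero (n * j) hp0) (ENNReal.pow_ne_top hpt (n := n * j))
  calc _ = 1 * ((p : ℝ≥0∞) ^ r * p ^ j * vol n p (X ∩ tube α p (r + j))) := by ring
    _ = _ := by rw [← h2]; simp only [ENNReal.inv_pow]; ring

theorem continuous_scale (c : Fin 3 → ℚ_[p]) :
    Continuous (scale c : (Coord n → ℚ_[p]) → Coord n → ℚ_[p]) := by
  unfold scale; fun_prop

theorem leray_scale (a : Fin 3 → ℕ) {D : Set (Coord n → ℚ_[p])} (hc : IsCompact D)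
    (ho : IsOpen D) (hc' : IsCompact (scale (powers p a) ⁻¹' D))
    (hD : ∀ t ∈ D, F α t = 0 → ∃ m, dF α m t ≠ 0) :
    leray α p D = ((p : ℝ≥0∞) ^ n)⁻¹ ^ (∑ s, a s) * leray α p (scale (powers p a) ⁻¹' D) := by
  obtain ⟨R, hR⟩ := exists_vol_inter_tube_eq_leray α hc ho hD
  obtain ⟨S, hS⟩ := exists_vol_inter_tube_eq_leray α hc' (ho.preimage (continuous_scale _)) (by
    intro t ht hF
    obtain ⟨m, hm⟩ := hD _ ht (by rw [F_scale, hF, mul_zero])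
    exact ⟨m, fun h => hm (by rw [dF_scale, h, mul_zero])⟩)
  -- The two stable ranges are compared at levels differing by exactly the power of `p` that scaling
  -- puts into `F`.
  rw [← hR (max R S + ∑ s, a s) (by omega), ← hS (max R S) (by omega),
    pow_mul_vol_inter_tube_scale α a _ ho.measurableSet]

variable (n p) in
/-- The integral points with primitive blocks at the indices in `T`. -/
def box (T : Finset (Fin 3)) : Set (Coord n → ℚ_[p]) :=
  {t | (∀ l, ‖t l‖ ≤ 1) ∧ ∀ s ∈ T, ∃ i, ‖t (s, i)‖ = 1}

variable (n p) in
/-- The points with block norms `p ^ (-a s)`. -/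
def shell (a : Fin 3 → ℕ) : Set (Coord n → ℚ_[p]) :=
  {t | ∀ s, (∀ i, ‖t (s, i)‖ ≤ ‖powers p a s‖) ∧ ∃ i, ‖t (s, i)‖ = ‖powers p a s‖}

theorem shell_zero : shell n p 0 = box n p Finset.univ := by
  ext t
  simp only [shell, powers, box, Set.mem_ofPred_eq, Pi.zero_apply, pow_zero, norm_one,
    Finset.mem_univ, true_imp_iff, Prod.forall, forall_and]

theorem preimage_scale_shell (a : Fin 3 → ℕ) :
    scale (powers p a) ⁻¹' shell n p a = shell n p 0 := by
  ext t
  have h (s : Fin 3) : 0 < ‖powers p a s‖ := norm_pos_iff.2 (powers_ne_zero a s)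
  simp only [shell, scale, Set.mem_preimage, Set.mem_ofPred_eq, norm_mul]
  refine forall_congr' fun s => and_congr (forall_congr' fun i => ?_) (exists_congr fun i => ?_)
  · rw [mul_le_iff_le_one_right (h s)]; simp [powers]
  · rw [mul_eq_left₀ (h s).ne']; simp [powers]

theorem isClopen_setOf_norm_eq {X : Type*} [TopologicalSpace X] {f : X → ℚ_[p]}
    (hf : Continuous f) {ε : ℝ} (hε : ε ≠ 0) : IsClopen {t | ‖f t‖ = ε} := by
  convert (IsUltrametricDist.isClopen_sphere (0 : ℚ_[p]) hε).preimage hf using 1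
  ext; simp

theorem isClopen_setOf_norm_le {X : Type*} [TopologicalSpace X] {f : X → ℚ_[p]}
    (hf : Continuous f) {ε : ℝ} (hε : ε ≠ 0) : IsClopen {t | ‖f t‖ ≤ ε} := by
  convert (IsUltrametricDist.isClopen_closedBall (0 : ℚ_[p]) hε).preimage hf using 1
  ext; simp

theorem isClopen_shell (a : Fin 3 → ℕ) : IsClopen (shell n p a) := by
  have h (s : Fin 3) : ‖powers p a s‖ ≠ 0 := norm_ne_zero_iff.2 (powers_ne_zero a s)
  have : shell n p a = ⋂ s, ((⋂ i, {t | ‖t (s, i)‖ ≤ ‖powers p a s‖}) ∩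
      ⋃ i, {t | ‖t (s, i)‖ = ‖powers p a s‖}) := by
    ext t; simp [shell]
  rw [this]
  exact isClopen_iInter_of_finite fun s =>
    (isClopen_iInter_of_finite fun i => isClopen_setOf_norm_le (continuous_apply _) (h s)).inter
      (isClopen_iUnion_of_finite fun i => isClopen_setOf_norm_eq (continuous_apply _) (h s))

theorem isClopen_box (T : Finset (Fin 3)) : IsClopen (box n p T) := by
  have : box n p T = (⋂ l, {t | ‖t l‖ ≤ 1}) ∩ ⋂ s ∈ T, ⋃ i, {t | ‖t (s, i)‖ = 1} := by
    ext t; simp [box]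
  rw [this]
  exact (isClopen_iInter_of_finite fun l => isClopen_setOf_norm_le (continuous_apply _)
    one_ne_zero).inter (isClopen_biInter_finset fun s _ => isClopen_iUnion_of_finite fun i =>
      isClopen_setOf_norm_eq (continuous_apply _) one_ne_zero)

theorem isCompact_box (T : Finset (Fin 3)) : IsCompact (box n p T) := by
  refine (isCompact_closedBall 0 1).of_isClosed_subset (isClopen_box T).isClosed fun t ht => ?_
  rw [mem_closedBall_zero_iff, pi_norm_le_iff_of_nonneg zero_le_one]
  exact ht.1

theorem norm_powers_le_one (a : Fin 3 → ℕ) (s : Fin 3) : ‖powers p a s‖ ≤ 1 := by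
  rw [powers, norm_pow]
  exact pow_le_one₀ (norm_nonneg _) Padic.norm_p_lt_one.le

theorem shell_subset_box (a : Fin 3 → ℕ) : shell n p a ⊆ box n p ∅ :=
  fun t ht => ⟨fun l => ((ht l.1).1 l.2).trans (norm_powers_le_one a l.1), by simp⟩

theorem isCompact_shell (a : Fin 3 → ℕ) : IsCompact (shell n p a) :=
  (isCompact_box ∅).of_isClosed_subset (isClopen_shell a).isClosed (shell_subset_box a)

variable {α} in
theorem IsSmoothHypersurface.leray_shell (hV : IsSmoothHypersurface α) (a : Fin 3 → ℕ) :
    leray α p (shell n p a) =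
      ((p : ℝ≥0∞) ^ n)⁻¹ ^ (∑ s, a s) * leray α p (box n p Finset.univ) := by
  rw [leray_scale α a (isCompact_shell a) (isClopen_shell a).isOpen, preimage_scale_shell,
    shell_zero]
  · rw [preimage_scale_shell]
    exact isCompact_shell 0
  · intro t ht hF
    refine hV.exists_dF_ne_zero p t (fun s => ?_) hF
    obtain ⟨i, hi⟩ := (ht s).2
    exact ⟨i, norm_ne_zero_iff.1 (hi ▸ norm_ne_zero_iff.2 (powers_ne_zero a s))⟩

theorem pairwise_disjoint_shell :
    Pairwise (Function.onFun Disjoint (shell n p)) := by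
  intro a b hab
  refine Set.disjoint_left.2 fun t ha hb => hab (funext fun s => ?_)
  obtain ⟨i, hi⟩ := (ha s).2
  obtain ⟨j, hj⟩ := (hb s).2
  have h : ‖powers p a s‖ = ‖powers p b s‖ :=
    le_antisymm (hi ▸ (hb s).1 i) (hj ▸ (ha s).1 j)
  simp only [powers, norm_pow] at h
  exact pow_right_injective₀ (norm_pos_iff.2 natCast_prime_ne_zero) Padic.norm_p_lt_one.ne h

theorem exists_norm_eq_prime_pow {x : ℚ_[p]} (h0 : x ≠ 0) (h1 : ‖x‖ ≤ 1) :
    ∃ a : ℕ, ‖x‖ = ‖(p : ℚ_[p]) ^ a‖ := by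
  obtain ⟨x, rfl⟩ := exists_padicInt h1
  refine ⟨x.valuation, ?_⟩
  rw [Padic.norm_p_pow, ← PadicInt.norm_def, PadicInt.norm_eq_zpow_neg_valuation]
  exact fun h => h0 (by rw [h]; rfl)

/-- If every block is nonzero, the largest norm in each is a power of `p`, and the three exponents
name the shell. -/
theorem box_diff_iUnion_shell_subset :
    box n p ∅ \ ⋃ a, shell n p a ⊆ {t | ∃ s, ∀ i, t (s, i) = 0} := by
  intro t ht
  by_contra h
  simp only [Set.mem_ofPred_eq, not_exists, not_forall] at h
  have key (s : Fin 3) : ∃ a : ℕ, (∀ i, ‖t (s, i)‖ ≤ ‖(p : ℚ_[p]) ^ a‖) ∧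
      ∃ i, ‖t (s, i)‖ = ‖(p : ℚ_[p]) ^ a‖ := by
    obtain ⟨i, -, hi⟩ := Finset.exists_max_image Finset.univ (fun i => ‖t (s, i)‖)
      Finset.univ_nonempty
    obtain ⟨j, hj⟩ := h s
    have h0 : t (s, i) ≠ 0 :=
      norm_pos_iff.1 ((norm_pos_iff.2 hj).trans_le (hi j (Finset.mem_univ j)))
    obtain ⟨a, ha⟩ := exists_norm_eq_prime_pow h0 (ht.1.1 _)
    exact ⟨a, fun k => ha ▸ hi k (Finset.mem_univ k), i, ha⟩
  choose a ha using key
  exact ht.2 (Set.mem_iUnion.2 ⟨a, ha⟩)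

theorem lam_setOf_eq_zero {m l : Coord n} (h : l ≠ m) : lam α p m {t | t l = 0} = 0 := by
  have hs : MeasurableSet {t : Coord n → ℚ_[p] | t l = 0} :=
    measurable_pi_apply l (measurableSet_singleton 0)
  rw [lam_apply α m hs]
  refine setLIntegral_measure_zero _ _ (measure_mono_null ?_
    (Measure.pi_hyperplane (fun _ : {l : Coord n // l ≠ m} => haar p) ⟨l, h⟩ 0))
  rintro u ⟨-, hu⟩
  rwa [Set.mem_ofPred_eq, conePoint_apply_of_ne α m u l h] at hu

/-- Since `n ≥ 1`, every block has a coordinate other than `m`; its vanishing is a hyperplane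
condition on the parameters of the chart `m`, hence null. -/
theorem leray_setOf_block_eq_zero (hn : 1 ≤ n) :
    leray α p {t | ∃ s, ∀ i, t (s, i) = 0} = 0 := by
  have hs (l : Coord n) : MeasurableSet {t : Coord n → ℚ_[p] | t l = 0} :=
    measurable_pi_apply l (measurableSet_singleton 0)
  have hm : MeasurableSet {t : Coord n → ℚ_[p] | ∃ s, ∀ i, t (s, i) = 0} := by
    simp only [Set.ofPred_exists, Set.ofPred_forall]
    exact MeasurableSet.iUnion fun s => MeasurableSet.iInter fun i => hs (s, i)
  rw [leray_apply α hm]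
  refine Finset.sum_eq_zero fun m _ => measure_mono_null Set.inter_subset_left ?_
  simp only [Set.ofPred_exists]
  refine measure_iUnion_null fun s => ?_
  have : Nontrivial (Fin (n + 1)) := Fin.nontrivial_iff_two_le.2 (by omega)
  obtain ⟨i, hi⟩ := exists_ne m.2
  refine measure_mono_null (fun t ht => ht i)
    (lam_setOf_eq_zero α (l := (s, i)) fun h => hi (by rw [← h]))

theorem prime_pow_inv_lt_one (hn : 1 ≤ n) : ((p : ℝ≥0∞) ^ n)⁻¹ < 1 := by
  rw [ENNReal.inv_lt_one]
  exact one_lt_pow₀ (by exact_mod_cast hp.out.one_lt) (by omega)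

theorem tsum_pow_sum (q : ℝ≥0∞) : ∑' a : Fin 3 → ℕ, q ^ (∑ s, a s) = (1 - q)⁻¹ ^ 3 := by
  let e : ℕ × ℕ × ℕ ≃ (Fin 3 → ℕ) :=
    { toFun := fun x => ![x.1, x.2.1, x.2.2]
      invFun := fun a => (a 0, a 1, a 2)
      left_inv := fun x => rfl
      right_inv := fun a => by ext s; fin_cases s <;> rfl }
  rw [← e.tsum_eq]
  have h (x : ℕ × ℕ × ℕ) : q ^ (∑ s, e x s) = q ^ x.1 * (q ^ x.2.1 * q ^ x.2.2) := by
    rw [Fin.sum_univ_three, pow_add, pow_add, mul_assoc]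
    rfl
  simp only [h]
  rw [ENNReal.tsum_prod (f := fun a (x : ℕ × ℕ) => q ^ a * (q ^ x.1 * q ^ x.2))]
  simp only [ENNReal.tsum_mul_left, ENNReal.tsum_mul_right, ENNReal.tsum_geometric]
  rw [ENNReal.tsum_prod (f := fun a b => q ^ a * q ^ b)]
  simp only [ENNReal.tsum_mul_left, ENNReal.tsum_mul_right, ENNReal.tsum_geometric]
  ring

variable {α} in
-- Up to a null set the integral points are the disjoint union of the shells, whose masses form a
-- product of three geometric series of ratio `p⁻ⁿ`.
theorem IsSmoothHypersurface.leray_box (hV : IsSmoothHypersurface α) (hn : 1 ≤ n) :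
    leray α p (box n p ∅) =
      (1 - ((p : ℝ≥0∞) ^ n)⁻¹)⁻¹ ^ 3 * leray α p (box n p Finset.univ) := by
  have h : leray α p (box n p ∅) = leray α p (⋃ a, shell n p a) := by
    refine le_antisymm ?_ (measure_mono (Set.iUnion_subset shell_subset_box))
    rw [← Set.sdiff_union_of_subset (Set.iUnion_subset (shell_subset_box (n := n) (p := p)))]
    refine (measure_union_le _ _).trans ?_
    rw [measure_mono_null box_diff_iUnion_shell_subset (leray_setOf_block_eq_zero α hn), zero_add]
  rw [h, measure_iUnion pairwise_disjoint_shell fun a => (isClopen_shell a).isOpen.measurableSet]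
  simp only [hV.leray_shell, ENNReal.tsum_mul_right, tsum_pow_sum]

/-! ### Densities of boxes and their recursion. -/

variable (p) in
/-- The density of the points of a box with `p ^ r ∣ F`. -/
noncomputable def dens (T : Finset (Fin 3)) (r : ℕ) : ℝ≥0∞ :=
  (p : ℝ≥0∞) ^ r * vol n p (box n p T ∩ tube α p r)

theorem dens_ne_top (T : Finset (Fin 3)) (r : ℕ) : dens α p T r ≠ ∞ :=
  ENNReal.mul_ne_top (by simp) (measure_ne_top_of_subset Set.inter_subset_left
    (vol_ne_top_of_isCompact (isCompact_box T)))

theorem norm_prime_mul_le_one_iff {x : ℚ_[p]} :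
    (‖p * x‖ ≤ 1 ∧ ‖p * x‖ ≠ 1) ↔ ‖x‖ ≤ 1 := by
  have h := Padic.norm_le_pow_iff_norm_lt_pow_add_one x 0
  have hp0 : (0 : ℝ) < p := by exact_mod_cast hp.out.pos
  rw [zpow_zero, zero_add, zpow_one] at h
  rw [h, ← lt_iff_le_and_ne, norm_mul, Padic.norm_p, inv_mul_lt_iff₀ hp0, mul_one]

theorem preimage_scale_box_diff {T : Finset (Fin 3)} {s : Fin 3} (hs : s ∉ T) :
    scale (powers p (Pi.single s 1)) ⁻¹' (box n p T \ box n p (insert s T)) = box n p T := by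
  have h1 (i : Fin (n + 1)) (t : Coord n → ℚ_[p]) :
      scale (powers p (Pi.single s 1)) t (s, i) = p * t (s, i) := by
    simp [scale, powers]
  have h2 (s' : Fin 3) (h : s' ≠ s) (i : Fin (n + 1)) (t : Coord n → ℚ_[p]) :
      scale (powers p (Pi.single s 1)) t (s', i) = t (s', i) := by
    simp [scale, powers, h]
  ext t
  simp only [Set.mem_preimage, Set.mem_sdiff, box, Set.mem_ofPred_eq, Finset.forall_mem_insert,
    Prod.forall]
  constructor
  · rintro ⟨⟨ha, hb⟩, hc⟩
    have hb' : ∀ s' ∈ T, ∃ i, ‖t (s', i)‖ = 1 := fun s' hs' => by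
      obtain ⟨i, hi⟩ := hb s' hs'
      exact ⟨i, by rwa [h2 s' (fun h => hs (h ▸ hs'))] at hi⟩
    refine ⟨fun s' i => ?_, hb'⟩
    by_cases h : s' = s
    · subst h
      refine norm_prime_mul_le_one_iff.1 ⟨h1 i t ▸ ha s' i, fun h => hc ⟨ha, ⟨i, ?_⟩, hb⟩⟩
      rwa [h1]
    · rw [← h2 s' h i t]; exact ha s' i
  · rintro ⟨ha, hb⟩
    have ha' : ∀ s' i, ‖scale (powers p (Pi.single s 1)) t (s', i)‖ ≤ 1 := fun s' i => by
      by_cases h : s' = s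
      · subst h; rw [h1]; exact (norm_prime_mul_le_one_iff.2 (ha s' i)).1
      · rw [h2 s' h]; exact ha s' i
    refine ⟨⟨ha', fun s' hs' => ?_⟩, ?_⟩
    · obtain ⟨i, hi⟩ := hb s' hs'
      exact ⟨i, by rwa [h2 s' (fun h => hs (h ▸ hs'))]⟩
    · rintro ⟨-, ⟨i, hi⟩, -⟩
      rw [h1] at hi
      exact (norm_prime_mul_le_one_iff.2 (ha s i)).2 hi

/-- Split according to whether the block `s` is primitive. If it is not, dividing it by `p` gives
back the whole box of `T` with the level of the tube lowered by one. No smoothness is used. -/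
theorem dens_succ {T : Finset (Fin 3)} {s : Fin 3} (hs : s ∉ T) (r : ℕ) :
    dens α p T (r + 1) =
      dens α p (insert s T) (r + 1) + ((p : ℝ≥0∞) ^ n)⁻¹ * dens α p T r := by
  have hsub : box n p (insert s T) ⊆ box n p T :=
    fun t ht => ⟨ht.1, fun s' hs' => ht.2 s' (Finset.mem_insert_of_mem hs')⟩
  have hm := (isClopen_box (n := n) (p := p) (insert s T)).isOpen.measurableSet
  have hm' := (isClopen_box (n := n) (p := p) T).isOpen.measurableSet
  have h := pow_mul_vol_inter_tube_scale α (Pi.single s 1) r (hm'.diff hm)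
  rw [preimage_scale_box_diff hs, Finset.sum_pi_single' s 1 Finset.univ] at h
  simp only [Finset.mem_univ, if_true, pow_one] at h
  rw [dens, dens, dens, ← h, ← mul_add]
  congr 1
  rw [← measure_inter_add_sdiff (box n p T ∩ tube α p (r + 1)) hm]
  congr 2
  · rw [Set.inter_right_comm, Set.inter_eq_right.2 hsub]
  · rw [Set.inter_sdiff_right_comm]

end Scaling

/-! ### Densities as point counts and as partial sums of `σ_p`. -/

section Counting

variable {n : ℕ} (α : Fin (n + 1) → Fin (n + 1) → Fin (n + 1) → ℤ) {p : ℕ} [hp : Fact p.Prime]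

theorem vol_setOf_forall_red_eq (r : ℕ) (b : Coord n → ZMod (p ^ r)) :
    vol n p {t | ∀ l, ‖t l‖ ≤ 1 ∧ red p r (t l) = b l} = ((p : ℝ≥0∞) ^ (r * (3 * n + 3)))⁻¹ := by
  have : {t : Coord n → ℚ_[p] | ∀ l, ‖t l‖ ≤ 1 ∧ red p r (t l) = b l} =
      Set.univ.pi fun l => {x | ‖x‖ ≤ 1 ∧ red p r x = b l} := by
    ext; simp
  rw [this, vol, Measure.pi_pi]
  simp only [setOf_red_eq, haar_closedBall_pow_neg, Finset.prod_const, Finset.card_univ,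
    Fintype.card_prod, Fintype.card_fin]
  rw [← ENNReal.inv_pow, ← pow_mul]
  congr 3

theorem vol_setOf_red_mem (r : ℕ) (B : Set (Coord n → ZMod (p ^ r))) :
    vol n p {t | (∀ l, ‖t l‖ ≤ 1) ∧ (fun l => red p r (t l)) ∈ B} =
      Nat.card B * ((p : ℝ≥0∞) ^ (r * (3 * n + 3)))⁻¹ := by
  have h : {t : Coord n → ℚ_[p] | (∀ l, ‖t l‖ ≤ 1) ∧ (fun l => red p r (t l)) ∈ B} =
      ⋃ b : B, {t | ∀ l, ‖t l‖ ≤ 1 ∧ red p r (t l) = b.1 l} := by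
    ext t
    simp only [Set.mem_ofPred_eq, Set.mem_iUnion, Subtype.exists, forall_and, exists_and_left,
      exists_prop]
    refine and_congr_right fun _ => ⟨fun h => ⟨_, h, fun _ => rfl⟩, ?_⟩
    rintro ⟨b, hb, h⟩
    rwa [funext h]
  have hm (b : B) : MeasurableSet {t : Coord n → ℚ_[p] | ∀ l, ‖t l‖ ≤ 1 ∧ red p r (t l) = b.1 l} := by
    simp only [Set.ofPred_forall]
    refine MeasurableSet.iInter fun l => ?_
    have h1 : MeasurableSet {x : ℚ_[p] | ‖x‖ ≤ 1 ∧ red p r x = b.1 l} := by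
      rw [setOf_red_eq]; exact Metric.isClosed_closedBall.measurableSet
    exact (measurable_pi_apply l : Measurable fun t : Coord n → ℚ_[p] => t l) h1
  have := Fintype.ofFinite B
  rw [h, measure_iUnion _ hm]
  · simp only [vol_setOf_forall_red_eq, tsum_fintype, Finset.sum_const, Finset.card_univ,
      nsmul_eq_mul, Nat.card_eq_fintype_card]
  · intro a b hab
    refine Set.disjoint_left.2 fun t ha hb => hab (Subtype.ext (funext fun l => ?_))
    rw [← (ha l).2, (hb l).2]

theorem F_coe (x : Coord n → ℤ_[p]) : F α (fun l => (x l : ℚ_[p])) = (F α x : ℤ_[p]) :=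
  map_F α PadicInt.Coe.ringHom x

theorem F_red {t : Coord n → ℚ_[p]} (ht : ∀ l, ‖t l‖ ≤ 1) (r : ℕ) :
    F α (fun l => red p r (t l)) = red p r (F α t) := by
  choose x hx using fun l => exists_padicInt (ht l)
  obtain rfl : (fun l => (x l : ℚ_[p])) = t := funext hx
  simp only [red_coe, map_F, F_coe]

theorem norm_F_le_one {t : Coord n → ℚ_[p]} (ht : ∀ l, ‖t l‖ ≤ 1) : ‖F α t‖ ≤ 1 := by
  choose x hx using fun l => exists_padicInt (ht l)
  obtain rfl : (fun l => (x l : ℚ_[p])) = t := funext hx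
  rw [F_coe]
  exact (F α x).2

theorem F_red_eq_zero_iff {t : Coord n → ℚ_[p]} (ht : ∀ l, ‖t l‖ ≤ 1) (r : ℕ) :
    F α (fun l => red p r (t l)) = 0 ↔ t ∈ tube α p r := by
  rw [F_red α ht, red_eq_zero_iff (norm_F_le_one α ht), tube, Set.mem_ofPred_eq, Padic.norm_p_pow]

theorem prime_mul_F_red_eq_zero_iff {t : Coord n → ℚ_[p]} (ht : ∀ l, ‖t l‖ ≤ 1) (r : ℕ) :
    (p : ZMod (p ^ (r + 1))) * F α (fun l => red p (r + 1) (t l)) = 0 ↔ t ∈ tube α p r := by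
  have h1 := norm_F_le_one α ht
  obtain ⟨x, hx⟩ := exists_padicInt h1
  have h2 : ‖(p : ℚ_[p]) * F α t‖ ≤ 1 := by
    rw [norm_mul]
    exact mul_le_one₀ Padic.norm_p_lt_one.le (norm_nonneg _) h1
  have h3 : (p : ZMod (p ^ (r + 1))) * red p (r + 1) (F α t) = red p (r + 1) (p * F α t) := by
    rw [← hx, ← PadicInt.coe_natCast, ← PadicInt.coe_mul, red_coe, red_coe, map_mul, map_natCast]
  rw [F_red α ht, h3, red_eq_zero_iff h2, tube, Set.mem_ofPred_eq, ← Padic.norm_p_pow, pow_succ',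
    norm_mul, norm_mul]
  exact mul_le_mul_iff_right₀ (norm_pos_iff.2 natCast_prime_ne_zero)

theorem toReal_card_mul {n p : ℕ} (r c s : ℕ) :
    ((p : ℝ≥0∞) ^ s * (c * ((p : ℝ≥0∞) ^ (r * (3 * n + 3)))⁻¹)).toReal =
      ((p : ℝ) ^ (r * (3 * n + 3)))⁻¹ * (p ^ s * c) := by
  simp only [ENNReal.toReal_mul, ENNReal.toReal_pow, ENNReal.toReal_natCast, ENNReal.toReal_inv]
  ring

theorem toReal_dens (r : ℕ) : (dens α p ∅ r).toReal =
    ((p : ℝ) ^ (r * (3 * n + 3)))⁻¹ *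
      (p ^ r * Nat.card {b : Coord n → ZMod (p ^ r) | F α b = 0}) := by
  rw [← toReal_card_mul, ← vol_setOf_red_mem, dens]
  congr 3
  ext t
  simp only [box, Set.mem_inter_iff, Set.mem_ofPred_eq, Finset.notMem_empty, false_imp_iff,
    imp_true_iff, and_true]
  exact and_congr_right fun ht => (F_red_eq_zero_iff α ht r).symm

/-- The density at level `r`, counted modulo `p ^ (r + 1)`: this is the second term of the Ramanujan
sum. -/
theorem toReal_dens_eq_card_prime_mul (r : ℕ) : (dens α p ∅ r).toReal =
    ((p : ℝ) ^ ((r + 1) * (3 * n + 3)))⁻¹ *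
      (p ^ r * Nat.card {b : Coord n → ZMod (p ^ (r + 1)) |
        (p : ZMod (p ^ (r + 1))) * F α b = 0}) := by
  rw [← toReal_card_mul, ← vol_setOf_red_mem, dens]
  congr 3
  ext t
  simp only [box, Set.mem_inter_iff, Set.mem_ofPred_eq, Finset.notMem_empty, false_imp_iff,
    imp_true_iff, and_true]
  exact and_congr_right fun ht => (prime_mul_F_red_eq_zero_iff α ht r).symm

/-- Divisibility by `p` is visible modulo `p ^ r` only for `r > 0`; in the zero ring everything is
divisible. -/
theorem prime_dvd_red_iff {r : ℕ} (hr : r ≠ 0) {x : ℚ_[p]} (hx : ‖x‖ ≤ 1) :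
    ¬ (p : ZMod (p ^ r)) ∣ red p r x ↔ ‖x‖ = 1 := by
  obtain ⟨x, rfl⟩ := exists_padicInt hx
  rw [red_coe]
  have h1 : (p : ZMod (p ^ r)) ∣ PadicInt.toZModPow r x ↔ (p : ℤ_[p]) ∣ x := by
    constructor
    · rintro ⟨y, hy⟩
      obtain ⟨y, rfl⟩ := ZMod.ringHom_surjective (PadicInt.toZModPow (p := p) r) y
      rw [← map_natCast (PadicInt.toZModPow (p := p) r), ← map_mul, ← sub_eq_zero, ← map_sub,
        ← RingHom.mem_ker, PadicInt.ker_toZModPow, Ideal.mem_span_singleton] at hy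
      have := (dvd_pow_self (p : ℤ_[p]) hr).trans hy
      exact (dvd_sub_left (dvd_mul_right _ _)).1 this
    · intro h
      simpa using map_dvd (PadicInt.toZModPow (p := p) r) h
  rw [h1, ← PadicInt.norm_lt_one_iff_dvd, ← PadicInt.norm_def, not_lt]
  exact ⟨fun h => le_antisymm x.2 h, fun h => h.ge⟩

theorem primCount_div {r : ℕ} (hr : r ≠ 0) :
    (primCount α p r : ℝ) / (p : ℝ) ^ (r * (3 * n + 2)) = (dens α p Finset.univ r).toReal := by
  have hp0 : (p : ℝ) ≠ 0 := by exact_mod_cast hp.out.ne_zero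
  have h : box n p Finset.univ ∩ tube α p r =
      {t | (∀ l, ‖t l‖ ≤ 1) ∧ (fun l => red p r (t l)) ∈
        {t : Coord n → ZMod (p ^ r) |
          (∀ s, ∃ i, ¬ (p : ZMod (p ^ r)) ∣ t (s, i)) ∧ F α t = 0}} := by
    ext t
    simp only [box, Set.mem_inter_iff, Set.mem_ofPred_eq, Finset.mem_univ, true_imp_iff, and_assoc]
    refine and_congr_right fun ht => ?_
    rw [F_red_eq_zero_iff α ht]
    simp only [prime_dvd_red_iff hr (ht _)]
  rw [dens, h, vol_setOf_red_mem, toReal_card_mul]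
  have h2 : (p : ℝ) ^ (r * (3 * n + 3)) = p ^ (r * (3 * n + 2)) * p ^ r := by
    rw [← pow_add]; congr 1
  rw [h2, primCount]
  field_simp
  rfl

theorem sum_range_stdAddChar {q : ℕ} [NeZero q] (N : ℕ) (x : ZMod q) (hN : (N : ZMod q) * x = 0) :
    ∑ a ∈ Finset.range N, ZMod.stdAddChar ((a : ZMod q) * x) = if x = 0 then (N : ℂ) else 0 := by
  have h (a : ℕ) : ZMod.stdAddChar ((a : ZMod q) * x) = ZMod.stdAddChar x ^ a := by
    rw [← nsmul_eq_mul, AddChar.map_nsmul_eq_pow]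
  split_ifs with hx
  · simp [hx]
  · simp only [h]
    have h1 : ZMod.stdAddChar x ≠ 1 := fun h1 => hx (by
      rw [← AddChar.map_zero_eq_one (ZMod.stdAddChar (N := q))] at h1
      exact ZMod.injective_stdAddChar h1)
    rw [geom_sum_eq h1, ← h, hN, AddChar.map_zero_eq_one, sub_self, zero_div]

/-- A Ramanujan sum: the full character sum minus the part over `a = p a'` with `a' < p ^ k`, each
evaluated by orthogonality. -/
theorem sum_coprime_stdAddChar (k : ℕ) (x : ZMod (p ^ (k + 1))) :
    ∑ a ∈ (Finset.range (p ^ (k + 1))).filter (fun a => Nat.gcd a (p ^ (k + 1)) = 1),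
      ZMod.stdAddChar ((a : ZMod (p ^ (k + 1))) * x) =
    (if x = 0 then ((p ^ (k + 1) : ℕ) : ℂ) else 0) -
      if (p : ZMod (p ^ (k + 1))) * x = 0 then ((p ^ k : ℕ) : ℂ) else 0 := by
  have hq : ((p ^ (k + 1) : ℕ) : ZMod (p ^ (k + 1))) = 0 := ZMod.natCast_self _
  rw [← sum_range_stdAddChar _ x (by rw [hq, zero_mul]), ← sum_range_stdAddChar (p ^ k)
    ((p : ZMod (p ^ (k + 1))) * x) (by
      rw [← mul_assoc, ← Nat.cast_mul, ← pow_succ, hq, zero_mul]), eq_sub_iff_add_eq,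
    ← Finset.sum_filter_add_sum_filter_not (Finset.range (p ^ (k + 1)))
      (fun a => Nat.gcd a (p ^ (k + 1)) = 1)]
  congr 1
  have hcop (a : ℕ) : ¬ Nat.gcd a (p ^ (k + 1)) = 1 ↔ p ∣ a := by
    rw [← Nat.coprime_iff_gcd_eq_one, Nat.coprime_pow_right_iff (Nat.succ_pos k), Nat.coprime_comm,
      hp.out.coprime_iff_not_dvd, not_not]
  simp only [hcop]
  refine Finset.sum_nbij' (p * ·) (· / p) ?_ ?_ ?_ ?_ ?_
  · intro a ha
    simp only [Finset.mem_filter, Finset.mem_range, dvd_mul_right, and_true] at ha ⊢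
    rw [pow_succ']
    exact Nat.mul_lt_mul_of_pos_left ha hp.out.pos
  · intro a ha
    simp only [Finset.mem_filter, Finset.mem_range] at ha ⊢
    rw [Nat.div_lt_iff_lt_mul hp.out.pos, ← pow_succ]
    exact ha.1
  · intro a _
    exact Nat.mul_div_cancel_left a hp.out.pos
  · intro a ha
    exact Nat.mul_div_cancel' (Finset.mem_filter.1 ha).2
  · intro a _
    push_cast
    ring_nf

theorem A_zero : A α (p ^ 0) = ((dens α p ∅ 0).toReal : ℂ) := by
  rw [toReal_dens, A]
  have h1 : (Finset.range (p ^ 0)).filter (fun a => Nat.gcd a (p ^ 0) = 1) = {0} := by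
    ext a; simp
  have hs : Subsingleton (ZMod (p ^ 0)) := by rw [pow_zero]; infer_instance
  rw [h1, Finset.sum_singleton]
  have h2 (b : Coord n → ZMod (p ^ 0)) :
      ZMod.stdAddChar (((0 : ℕ) : ZMod (p ^ 0)) * F α b) = 1 := by
    rw [Subsingleton.elim (((0 : ℕ) : ZMod (p ^ 0)) * F α b) 0, AddChar.map_zero_eq_one]
  have h3 : {b : Coord n → ZMod (p ^ 0) | F α b = 0} = Set.univ :=
    Set.eq_univ_of_forall fun b => Subsingleton.elim _ _
  simp only [h2, h3, Finset.sum_const, Finset.card_univ]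
  simp

theorem sum_ite_eq_card {β : Type*} [Fintype β] (P : β → Prop) [DecidablePred P] (c : ℂ) :
    ∑ b, (if P b then c else 0) = c * Nat.card {b | P b} := by
  rw [← Finset.sum_filter, Finset.sum_const, nsmul_eq_mul, mul_comm, Nat.card_eq_fintype_card,
    Fintype.card_subtype]
  rfl

theorem A_succ (k : ℕ) :
    A α (p ^ (k + 1)) = ((dens α p ∅ (k + 1)).toReal : ℂ) - ((dens α p ∅ k).toReal : ℂ) := by
  rw [toReal_dens, toReal_dens_eq_card_prime_mul, A, Finset.sum_comm]
  simp only [sum_coprime_stdAddChar, Finset.sum_sub_distrib, sum_ite_eq_card]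
  push_cast
  rw [← mul_sub, ← pow_mul]

end Counting

/-! ### Real sequences with `w (r + 1) = u (r + 1) + q * w r`. -/

section Recursion

/-- The partial sums `S` of `|d|` satisfy `S ≤ |d 0| + ∑ |e| + q S`, which bounds them because `q <
1`. -/
theorem summable_of_succ_eq_add_mul {d e : ℕ → ℝ} {q : ℝ} (h0 : 0 ≤ q) (h1 : q < 1)
    (h : ∀ r, d (r + 1) = e (r + 1) + q * d r) (he : Summable e) : Summable d := by
  refine Summable.of_norm ?_
  have he' := he.norm
  refine summable_of_sum_range_le (c := (|d 0| + ∑' r, ‖e r‖) / (1 - q))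
    (fun r => norm_nonneg _) fun N => ?_
  rw [le_div_iff₀ (by linarith)]
  cases N with
  | zero =>
    have : 0 ≤ ∑' r, ‖e r‖ := tsum_nonneg fun r => norm_nonneg (e r)
    have := abs_nonneg (d 0)
    simp only [Finset.range_zero, Finset.sum_empty, zero_mul]
    linarith
  | succ N =>
    have h2 : ∑ r ∈ Finset.range N, ‖d (r + 1)‖ ≤
        ∑ r ∈ Finset.range N, ‖e (r + 1)‖ + q * ∑ r ∈ Finset.range N, ‖d r‖ := by
      rw [Finset.mul_sum, ← Finset.sum_add_distrib]
      refine Finset.sum_le_sum fun r _ => ?_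
      rw [h]
      refine (norm_add_le _ _).trans ?_
      rw [norm_mul, Real.norm_of_nonneg h0]
    have h3 : ∑ r ∈ Finset.range N, ‖e (r + 1)‖ ≤ ∑' r, ‖e r‖ := by
      have := he'.sum_le_tsum (Finset.range (N + 1)) fun r _ => norm_nonneg _
      rw [Finset.sum_range_succ'] at this
      linarith [norm_nonneg (e 0)]
    have h4 : ∑ r ∈ Finset.range N, ‖d r‖ ≤ ∑ r ∈ Finset.range (N + 1), ‖d r‖ :=
      Finset.sum_le_sum_of_subset_of_nonneg (Finset.range_mono N.le_succ)
        fun r _ _ => norm_nonneg _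
    have h5 := mul_le_mul_of_nonneg_left h4 h0
    have h6 : ∑ r ∈ Finset.range (N + 1), ‖d r‖ = ∑ r ∈ Finset.range N, ‖d (r + 1)‖ + |d 0| :=
      Finset.sum_range_succ' _ _
    rw [mul_one_sub, mul_comm _ q]
    linarith

theorem tendsto_of_summable_sub {w : ℕ → ℝ} (h : Summable fun r => w (r + 1) - w r) :
    ∃ W, Tendsto w atTop (𝓝 W) := by
  have h1 := h.hasSum.tendsto_sum_nat
  simp only [Finset.sum_range_sub] at h1
  exact ⟨_, by simpa using h1.add_const (w 0)⟩

theorem summable_sub_and_tendsto {w u : ℕ → ℝ} {q U : ℝ} (h0 : 0 ≤ q) (h1 : q < 1)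
    (h : ∀ r, w (r + 1) = u (r + 1) + q * w r)
    (hu : (Summable fun r => u (r + 1) - u r) ∧ Tendsto u atTop (𝓝 U)) :
    (Summable fun r => w (r + 1) - w r) ∧ Tendsto w atTop (𝓝 ((1 - q)⁻¹ * U)) := by
  have hs : Summable fun r => w (r + 1) - w r :=
    -- Consecutive differences obey the same recursion. Once a limit `W` exists, it is forced by `W
    -- = U + q W`.
    summable_of_succ_eq_add_mul h0 h1 (fun r => by rw [h (r + 1), h r]; ring) hu.1
  obtain ⟨W, hW⟩ := tendsto_of_summable_sub hs
  have h2 := (hu.2.comp (tendsto_add_atTop_nat 1)).add (hW.const_mul q)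
  have h3 := tendsto_nhds_unique (hW.comp (tendsto_add_atTop_nat 1))
    (h2.congr fun r => (h r).symm)
  refine ⟨hs, ?_⟩
  convert hW using 2
  rw [inv_mul_eq_iff_eq_mul₀ (by linarith)]
  linarith

end Recursion

/-! ### Convergence of `σ_p` and its value. -/

section Density

variable {n : ℕ} {α : Fin (n + 1) → Fin (n + 1) → Fin (n + 1) → ℤ} {p : ℕ} [hp : Fact p.Prime]

theorem IsSmoothHypersurface.exists_dens_eq (hV : IsSmoothHypersurface α) :
    ∃ R, ∀ r ≥ R, dens α p Finset.univ r = leray α p (box n p Finset.univ) := by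
  refine exists_vol_inter_tube_eq_leray α (isCompact_box _) (isClopen_box _).isOpen
    fun t ht hF => hV.exists_dF_ne_zero p t (fun s => ?_) hF
  obtain ⟨i, hi⟩ := ht.2 s (Finset.mem_univ s)
  exact ⟨i, norm_ne_zero_iff.1 (by rw [hi]; exact one_ne_zero)⟩

theorem IsSmoothHypersurface.leray_box_univ_ne_top (hV : IsSmoothHypersurface α) :
    leray α p (box n p Finset.univ) ≠ ∞ := by
  obtain ⟨R, hR⟩ := hV.exists_dens_eq (p := p)
  rw [← hR R le_rfl]
  exact dens_ne_top α _ _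

theorem IsSmoothHypersurface.leray_box_ne_top (hV : IsSmoothHypersurface α) (hn : 1 ≤ n) :
    leray α p (box n p ∅) ≠ ∞ := by
  rw [hV.leray_box hn]
  exact ENNReal.mul_ne_top (ENNReal.pow_ne_top (ENNReal.inv_ne_top.2
    (tsub_pos_of_lt (prime_pow_inv_lt_one hn)).ne')) hV.leray_box_univ_ne_top

theorem prime_pow_real_inv_lt_one (hn : 1 ≤ n) : ((p : ℝ) ^ n)⁻¹ < 1 :=
  inv_lt_one_of_one_lt₀ (one_lt_pow₀ (by exact_mod_cast hp.out.one_lt) (by omega))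

theorem IsSmoothHypersurface.toReal_leray_box (hV : IsSmoothHypersurface α) (hn : 1 ≤ n) :
    (leray α p (box n p ∅)).toReal =
      (1 - ((p : ℝ) ^ n)⁻¹)⁻¹ ^ 3 * (leray α p (box n p Finset.univ)).toReal := by
  rw [hV.leray_box hn, ENNReal.toReal_mul, ENNReal.toReal_pow, ENNReal.toReal_inv,
    ENNReal.toReal_sub_of_le (prime_pow_inv_lt_one hn).le ENNReal.one_ne_top]
  simp

theorem IsSmoothHypersurface.tendsto_dens_univ (hV : IsSmoothHypersurface α) :
    (Summable fun r => (dens α p Finset.univ (r + 1)).toReal -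
      (dens α p Finset.univ r).toReal) ∧
    Tendsto (fun r => (dens α p Finset.univ r).toReal) atTop
      (𝓝 (leray α p (box n p Finset.univ)).toReal) := by
  obtain ⟨R, hR⟩ := hV.exists_dens_eq (p := p)
  refine ⟨summable_of_ne_finset_zero (s := Finset.range R) fun r hr => ?_, ?_⟩
  · rw [Finset.mem_range, not_lt] at hr
    rw [hR r hr, hR (r + 1) (by omega), sub_self]
  · refine tendsto_const_nhds.congr' ?_
    filter_upwards [eventually_ge_atTop R] with r hr
    rw [hR r hr]

theorem toReal_dens_succ {T : Finset (Fin 3)} {s : Fin 3} (hs : s ∉ T) (r : ℕ) :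
    (dens α p T (r + 1)).toReal =
      (dens α p (insert s T) (r + 1)).toReal + ((p : ℝ) ^ n)⁻¹ * (dens α p T r).toReal := by
  rw [dens_succ α hs, ENNReal.toReal_add (dens_ne_top α _ _), ENNReal.toReal_mul]
  · simp
  · exact ENNReal.mul_ne_top (by simp [hp.out.ne_zero]) (dens_ne_top α _ _)

/-- The fully primitive density is eventually constant. Dropping the primitivity conditions one
block at a time keeps the differences summable and multiplies the limit by `(1 - p⁻ⁿ)⁻¹` each time,
matching `leray_box`. -/
theorem IsSmoothHypersurface.tendsto_dens (hV : IsSmoothHypersurface α) (hn : 1 ≤ n) :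
    (Summable fun r => (dens α p ∅ (r + 1)).toReal - (dens α p ∅ r).toReal) ∧
    Tendsto (fun r => (dens α p ∅ r).toReal) atTop
      (𝓝 (leray α p (box n p ∅)).toReal) := by
  have h0 : 0 ≤ ((p : ℝ) ^ n)⁻¹ := by positivity
  have h1 := prime_pow_real_inv_lt_one (p := p) hn
  have huniv : (Finset.univ : Finset (Fin 3)) = insert 0 (insert 1 (insert 2 ∅)) := by decide
  have h := hV.tendsto_dens_univ (p := p)
  rw [huniv] at h
  have h2 := summable_sub_and_tendsto (w := fun r => (dens α p (insert 1 (insert 2 ∅)) r).toReal)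
    (u := fun r => (dens α p (insert 0 (insert 1 (insert 2 ∅))) r).toReal) h0 h1
    (toReal_dens_succ (α := α) (p := p) (T := insert 1 (insert 2 ∅)) (s := 0) (by decide)) h
  have h3 := summable_sub_and_tendsto (w := fun r => (dens α p (insert 2 ∅) r).toReal)
    (u := fun r => (dens α p (insert 1 (insert 2 ∅)) r).toReal) h0 h1
    (toReal_dens_succ (α := α) (p := p) (T := insert 2 ∅) (s := 1) (by decide)) h2
  have h4 := summable_sub_and_tendsto (w := fun r => (dens α p (∅) r).toReal)
    (u := fun r => (dens α p (insert 2 (∅)) r).toReal) h0 h1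
    (toReal_dens_succ (α := α) (p := p) (T := ∅) (s := 2) (by decide)) h3
  refine ⟨h4.1, ?_⟩
  have h5 := h4.2
  rwa [← mul_assoc, ← mul_assoc, ← pow_two, ← pow_succ, ← huniv, ← hV.toReal_leray_box hn] at h5

theorem IsSmoothHypersurface.hasSum_A (hV : IsSmoothHypersurface α) (hn : 1 ≤ n) :
    HasSum (fun k => A α (p ^ k)) ((leray α p (box n p ∅)).toReal : ℂ) := by
  obtain ⟨hs, ht⟩ := hV.tendsto_dens (p := p) hn
  have h1 : (fun k => A α (p ^ (k + 1))) =
      fun k => (((dens α p ∅ (k + 1)).toReal - (dens α p ∅ k).toReal : ℝ) : ℂ) := by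
    funext k
    rw [A_succ, Complex.ofReal_sub]
  have h2 := (hs.hasSum_iff_tendsto_nat
    (m := (leray α p (box n p ∅)).toReal - (dens α p ∅ 0).toReal)).2 (by
      simp only [Finset.sum_range_sub (fun r => (dens α p ∅ r).toReal)]
      exact ht.sub_const _)
  have h3 := Complex.hasSum_ofReal.2 h2
  rw [← h1] at h3
  -- The telescoping series starts at `k = 1`; the term `A(1)`, equal to the density at level `0`,
  -- is put back here.
  have h4 := (hasSum_nat_add_iff (f := fun k => A α (p ^ k)) 1).1 h3
  rwa [Finset.sum_range_one, A_zero, ← Complex.ofReal_add, sub_add_cancel] at h4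

theorem integralCone_eq : integralCone α p = box n p ∅ ∩ {t | F α t = 0} := by
  ext t; simp [integralCone, box]

theorem primitiveCone_eq : primitiveCone α p = box n p Finset.univ ∩ {t | F α t = 0} := by
  ext t; simp [integralCone, primitiveCone, box]; tauto

/-- The Leray measure is carried by the cone, so the clopen boxes can stand in for their
intersections with it. -/
theorem leray_inter_setOf_F_eq_zero {B : Set (Coord n → ℚ_[p])} (hB : MeasurableSet B) :
    leray α p (B ∩ {t | F α t = 0}) = leray α p B := by
  have hm : MeasurableSet {t : Coord n → ℚ_[p] | F α t = 0} :=
    (continuous_F α).measurable (measurableSet_singleton 0)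
  rw [← measure_inter_add_sdiff B hm, leray_eq_zero α (hB.diff hm) fun t ht => ht.2, add_zero]

theorem leray_integralCone : leray α p (integralCone α p) = leray α p (box n p ∅) := by
  rw [integralCone_eq, leray_inter_setOf_F_eq_zero (isClopen_box ∅).isOpen.measurableSet]

theorem leray_primitiveCone :
    leray α p (primitiveCone α p) = leray α p (box n p Finset.univ) := by
  rw [primitiveCone_eq, leray_inter_setOf_F_eq_zero (isClopen_box _).isOpen.measurableSet]

theorem IsSmoothHypersurface.tendsto_primCount (hV : IsSmoothHypersurface α) :
    Tendsto (fun r : ℕ => (primCount α p r : ℂ) / (p : ℂ) ^ (r * (3 * n + 2))) atTop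
      (𝓝 ((leray α p (box n p Finset.univ)).toReal : ℂ)) := by
  have h := (Complex.continuous_ofReal.tendsto _).comp (hV.tendsto_dens_univ (p := p)).2
  refine h.congr' ?_
  filter_upwards [eventually_ne_atTop 0] with r hr
  rw [Function.comp_apply, ← primCount_div α hr]
  push_cast
  rfl

end Density

/-! ### The cone in coordinates of `V` and three scaling parameters. -/

section Fibration

variable {n : ℕ} (α : Fin (n + 1) → Fin (n + 1) → Fin (n + 1) → ℤ) {p : ℕ} [hp : Fact p.Prime]

theorem update_scale {K : Type*} [Field K] (m : Coord n) (c : Fin 3 → K) (t : Coord n → K) (x : K) :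
    Function.update (scale c t) m (c m.1 * x) = scale c (Function.update t m x) := by
  ext l
  by_cases h : l = m
  · subst h; simp [scale]
  · simp [scale, h]

theorem solve_scale {K : Type*} [Field K] (m : Coord n) {c : Fin 3 → K} (hc : ∀ s, c s ≠ 0)
    (t : Coord n → K) : solve α m (scale c t) = scale c (solve α m t) := by
  have h0 : Function.update (scale c t) m 0 = scale c (Function.update t m 0) := by
    rw [← update_scale, mul_zero]
  have h1 : ∏ s ∈ Finset.univ.erase m.1, c s ≠ 0 := Finset.prod_ne_zero_iff.2 fun s _ => hc s
  rw [solve, solve, ← update_scale, h0, F_scale, dF_scale,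
    ← Finset.mul_prod_erase Finset.univ c (Finset.mem_univ m.1)]
  congr 1
  rw [neg_div, neg_div, mul_neg, mul_comm (c m.1), mul_assoc, mul_div_mul_left _ _ h1, mul_div_assoc]

/-- The normalised point with coordinates `v` in a chart and the coordinate `m` set to zero. -/
noncomputable def chartBase {K : Type*} [Field K] (q : Chart n) (v : q.Param → K) : Coord n → K :=
  fun l => if l.2 = q.1.1 l.1 then 1 else
    if h : l.2 ≠ q.1.1 l.1 ∧ l ≠ q.1.2 then v ⟨l, h⟩ else 0

theorem chartPoint_eq {K : Type*} [Field K] (q : Chart n) (v : q.Param → K) :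
    chartPoint α q v = solve α q.1.2 (chartBase q v) := rfl

/-- The coordinates other than the `m`-th, from the three coordinates normalised in a chart and
the coordinates of the chart. -/
noncomputable def joinCoords (q : Chart n) (x : (Fin 3 → ℚ_[p]) × (q.Param → ℚ_[p])) :
    {l : Coord n // l ≠ q.1.2} → ℚ_[p] :=
  fun l => if h : l.1.2 = q.1.1 l.1.1 then x.1 l.1.1 else x.2 ⟨l.1, h, l.2⟩

theorem measurable_joinCoords (q : Chart n) : Measurable (joinCoords (p := p) q) := by
  refine measurable_pi_lambda _ fun l => ?_
  unfold joinCoords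
  split_ifs <;> fun_prop

theorem normalised_ne (q : Chart n) (s : Fin 3) : ((s, q.1.1 s) : Coord n) ≠ q.1.2 :=
  fun h => q.2 (by rw [← h])

theorem prod_coord_ne (q : Chart n) (f : {l : Coord n // l ≠ q.1.2} → ℝ≥0∞) :
    ∏ l, f l = (∏ s, f ⟨(s, q.1.1 s), normalised_ne q s⟩) *
      ∏ l : q.Param, f ⟨l.1, l.2.2⟩ := by
  refine Eq.trans ?_ (Fintype.prod_sum_type (Sum.elim
    (fun s => f ⟨(s, q.1.1 s), normalised_ne q s⟩) fun l : q.Param => f ⟨l.1, l.2.2⟩))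
  refine (Fintype.prod_bijective
    (Sum.elim (fun s => ⟨(s, q.1.1 s), normalised_ne q s⟩) fun l : q.Param => ⟨l.1, l.2.2⟩)
    ⟨?_, ?_⟩ _ _ ?_).symm
  · rintro (s | l) (s' | l') h
    · simpa using congrArg (fun l => l.1.1) h
    · have h' : ((s, q.1.1 s) : Coord n) = l'.1 := congrArg Subtype.val h
      exact absurd (by rw [← h']) l'.2.1
    · have h' : l.1 = ((s', q.1.1 s') : Coord n) := congrArg Subtype.val h
      exact absurd (by rw [h']) l.2.1
    · exact congrArg Sum.inr (Subtype.ext (congrArg (fun l => l.1) h))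
  · intro l
    by_cases h : l.1.2 = q.1.1 l.1.1
    · exact ⟨Sum.inl l.1.1, Subtype.ext (Prod.ext rfl h.symm)⟩
    · exact ⟨Sum.inr ⟨l.1, h, l.2⟩, rfl⟩
  · rintro (s | l) <;> rfl

theorem map_joinCoords (q : Chart n) :
    ((Measure.pi fun _ : Fin 3 => haar p).prod (Measure.pi fun _ : q.Param => haar p)).map
      (joinCoords q) = Measure.pi fun _ : {l : Coord n // l ≠ q.1.2} => haar p := by
  refine (Measure.pi_eq fun s hs => ?_).symm
  rw [Measure.map_apply (measurable_joinCoords q) (MeasurableSet.univ_pi hs)]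
  have : joinCoords (p := p) q ⁻¹' Set.univ.pi s =
      (Set.univ.pi fun i => s ⟨(i, q.1.1 i), normalised_ne q i⟩) ×ˢ
        (Set.univ.pi fun l : q.Param => s ⟨l.1, l.2.2⟩) := by
    ext x
    simp only [Set.mem_preimage, Set.mem_pi, Set.mem_univ, true_imp_iff, Set.mem_prod, joinCoords]
    constructor
    · intro h
      exact ⟨fun i => by simpa using h ⟨(i, q.1.1 i), normalised_ne q i⟩,
        fun l => by simpa [l.2.1] using h ⟨l.1, l.2.2⟩⟩
    · rintro ⟨h1, h2⟩ l
      split_ifs with h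
      · have h3 := h1 l.1.1
        have h4 : (⟨(l.1.1, q.1.1 l.1.1), normalised_ne q l.1.1⟩ : {l : Coord n // l ≠ q.1.2}) =
          l := Subtype.ext (Prod.ext rfl h.symm)
        rwa [h4] at h3
      · exact h2 ⟨l.1, h, l.2⟩
  rw [this, Measure.prod_prod, Measure.pi_pi, Measure.pi_pi, prod_coord_ne]

/-- Solving for `t_m` commutes with rescaling the blocks, so the cone over a chart of `V` is its
product with the three scaling parameters. -/
theorem conePoint_joinCoords (q : Chart n) {τ : Fin 3 → ℚ_[p]} (hτ : ∀ s, τ s ≠ 0)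
    (v : q.Param → ℚ_[p]) :
    conePoint α q.1.2 (joinCoords q (τ, fun l => τ l.1.1 * v l)) =
      scale τ (chartPoint α q v) := by
  rw [chartPoint_eq, ← solve_scale α _ hτ, conePoint]
  congr 1
  ext l
  by_cases h : l = q.1.2
  · have := q.2
    subst h
    simp [scale, chartBase, this]
  · by_cases h' : l.2 = q.1.1 l.1
    · simp [scale, chartBase, joinCoords, h, h']
    · simp [scale, chartBase, joinCoords, h, h']

theorem conePoint_joinCoords_apply (q : Chart n) (x : (Fin 3 → ℚ_[p]) × (q.Param → ℚ_[p]))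
    (s : Fin 3) : conePoint α q.1.2 (joinCoords q x) (s, q.1.1 s) = x.1 s := by
  rw [conePoint_apply_of_ne α _ _ _ (normalised_ne q s)]
  simp [joinCoords]

theorem chartPoint_normalised {K : Type*} [Field K] (q : Chart n) (v : q.Param → K) (s : Fin 3) :
    chartPoint α q v (s, q.1.1 s) = 1 := by
  rw [chartPoint_eq, solve, Function.update_of_ne (normalised_ne q s)]
  simp [chartBase]

theorem lintegral_pi_haar_mul {ι : Type*} [Fintype ι] {c : ι → ℚ_[p]} (hc : ∀ i, c i ≠ 0)
    {g : (ι → ℚ_[p]) → ℝ≥0∞} (hg : Measurable g) :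
    ∫⁻ u, g u ∂(Measure.pi fun _ => haar p) =
      ∫⁻ u, (∏ i, ‖c i‖ₑ) * g (fun i => c i * u i) ∂(Measure.pi fun _ => haar p) := by
  have hm : Measurable fun (u : ι → ℚ_[p]) i => c i * u i := by fun_prop
  have h0 : ∏ i, ‖c i‖ₑ ≠ 0 := Finset.prod_ne_zero_iff.2 fun i _ => by simpa using hc i
  have h1 : ∏ i, ‖c i‖ₑ ≠ ∞ := ENNReal.prod_ne_top fun i _ => enorm_ne_top
  rw [lintegral_const_mul' _ _ h1, ← lintegral_map hg hm, pi_haar_map_mul c hc,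
    lintegral_smul_measure, smul_eq_mul, ← mul_assoc,
    ← ENNReal.prod_inv_distrib fun i _ j _ _ => Or.inr (by simp), ENNReal.mul_inv_cancel h0 h1,
    one_mul]

theorem measurable_chartPoint (q : Chart n) :
    Measurable (chartPoint α q : (q.Param → ℚ_[p]) → _) := by
  have hb : Measurable (chartBase q : (q.Param → ℚ_[p]) → _) := by
    refine measurable_pi_lambda _ fun l => ?_
    unfold chartBase
    split_ifs <;> fun_prop
  have h1 : Measurable fun v : q.Param → ℚ_[p] => Function.update (chartBase q v) q.1.2 0 := by
    refine measurable_pi_lambda _ fun l => ?_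
    by_cases h : l = q.1.2
    · subst h; simp
    · simp only [Function.update_of_ne h]; fun_prop
  have h2 : Measurable fun v : q.Param → ℚ_[p] =>
      -F α (Function.update (chartBase q v) q.1.2 0) / dF α q.1.2 (chartBase q v) :=
    ((continuous_F α).measurable.comp h1).neg.div ((continuous_dF α _).measurable.comp hb)
  refine measurable_pi_lambda _ fun l => ?_
  by_cases h : l = q.1.2
  · subst h; simpa [chartPoint_eq, solve] using h2
  · simp only [chartPoint_eq, solve, Function.update_of_ne h]; fun_prop

/-- For fixed `τ` substitute `w_l = τ_s v_l`, with `s` the block of `l`; this has Jacobian `∏ |τ_s|`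
over the chart coordinates. The hypothesis `h0` makes both integrands vanish when some `τ_s = 0`. -/
theorem lintegral_comp_conePoint (q : Chart n) {g : (Coord n → ℚ_[p]) → ℝ≥0∞} (hg : Measurable g)
    (h0 : ∀ t s, t (s, q.1.1 s) = 0 → g t = 0) :
    ∫⁻ u, g (conePoint α q.1.2 u) ∂(Measure.pi fun _ => haar p) =
      ∫⁻ v, ∫⁻ τ, (∏ l : q.Param, ‖τ l.1.1‖ₑ) * g (scale τ (chartPoint α q v))
        ∂(Measure.pi fun _ => haar p) ∂(Measure.pi fun _ => haar p) := by
  have hg' : Measurable fun u : {l : Coord n // l ≠ q.1.2} → ℚ_[p] => g (conePoint α q.1.2 u) :=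
    hg.comp (measurable_conePoint α q.1.2)
  have hg2 : Measurable fun x : (Fin 3 → ℚ_[p]) × (q.Param → ℚ_[p]) =>
      g (conePoint α q.1.2 (joinCoords q x)) := hg'.comp (measurable_joinCoords q)
  rw [← map_joinCoords, lintegral_map hg' (measurable_joinCoords q),
    lintegral_prod _ hg2.aemeasurable]
  have hsc : Measurable fun x : (Fin 3 → ℚ_[p]) × (q.Param → ℚ_[p]) =>
      scale x.1 (chartPoint α q x.2) := by
    have hch : Measurable fun x : (Fin 3 → ℚ_[p]) × (q.Param → ℚ_[p]) => chartPoint α q x.2 :=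
      (measurable_chartPoint α q).comp measurable_snd
    refine measurable_pi_lambda _ fun l => ?_
    exact ((measurable_pi_apply l.1).comp measurable_fst).mul ((measurable_pi_apply l).comp hch)
  have hmeas : Measurable fun x : (Fin 3 → ℚ_[p]) × (q.Param → ℚ_[p]) =>
      (∏ l : q.Param, ‖x.1 l.1.1‖ₑ) * g (scale x.1 (chartPoint α q x.2)) :=
    (Finset.measurable_prod _ fun l _ => by fun_prop).mul (hg.comp hsc)
  rw [← lintegral_lintegral_swap (f := fun (τ : Fin 3 → ℚ_[p]) (v : q.Param → ℚ_[p]) =>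
    (∏ l : q.Param, ‖τ l.1.1‖ₑ) * g (scale τ (chartPoint α q v))) hmeas.aemeasurable]
  refine lintegral_congr fun τ => ?_
  by_cases hτ : ∀ s, τ s ≠ 0
  · have hg3 : Measurable fun w : q.Param → ℚ_[p] =>
        g (conePoint α q.1.2 (joinCoords q (τ, w))) := hg2.comp measurable_prodMk_left
    rw [lintegral_pi_haar_mul (c := fun l : q.Param => τ l.1.1) (fun l => hτ _) hg3]
    refine lintegral_congr fun v => ?_
    simp only [conePoint_joinCoords α q hτ]
  · push Not at hτ
    obtain ⟨s, hs⟩ := hτ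
    refine lintegral_congr fun v => ?_
    rw [h0 (scale τ (chartPoint α q v)) s (by simp [scale, hs]), mul_zero]
    exact h0 _ s (by rw [conePoint_joinCoords_apply]; exact hs)

end Fibration

/-! ### The Tamagawa volume as the Leray mass of the primitive cone. -/

section Tamagawa

variable {n : ℕ} (α : Fin (n + 1) → Fin (n + 1) → Fin (n + 1) → ℤ) {p : ℕ} [hp : Fact p.Prime]

variable (p) in
/-- The points whose chart is `q`: the first nonvanishing coordinates and the first admissible
nonvanishing partial derivative are those of `q`. -/
def chartSet (q : Chart n) : Set (Coord n → ℚ_[p]) :=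
  firstAt (fun l t => l.2 ≠ q.1.1 l.1 ∧ dF α l t ≠ 0) q.1.2 ∩
    {t | ∀ s, t (s, q.1.1 s) ≠ 0 ∧ ∀ i < q.1.1 s, t (s, i) = 0}

theorem measurableSet_chartSet (q : Chart n) : MeasurableSet (chartSet α p q) := by
  have h (l : Coord n) : MeasurableSet {t : Coord n → ℚ_[p] | t l = 0} :=
    measurable_pi_apply l (measurableSet_singleton 0)
  refine (measurableSet_firstAt (fun l => ?_) _).inter ?_
  · by_cases hl : l.2 ≠ q.1.1 l.1
    · simpa [hl] using measurableSet_dF_ne_zero α l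
    · simp [hl]
  · simp only [Set.ofPred_forall, Set.ofPred_and]
    exact MeasurableSet.iInter fun s => (h _).compl.inter
      (MeasurableSet.iInter fun i => MeasurableSet.iInter fun _ => h _)

theorem dF_ne_zero_of_mem_chartSet {q : Chart n} {t : Coord n → ℚ_[p]} (ht : t ∈ chartSet α p q) :
    dF α q.1.2 t ≠ 0 := ht.1.1.2

theorem scale_mem_chartSet_iff (q : Chart n) {τ : Fin 3 → ℚ_[p]} (hτ : ∀ s, τ s ≠ 0)
    (t : Coord n → ℚ_[p]) : scale τ t ∈ chartSet α p q ↔ t ∈ chartSet α p q := by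
  have h (l : Coord n) : dF α l (scale τ t) = 0 ↔ dF α l t = 0 := by
    rw [dF_scale, mul_eq_zero, or_iff_right (Finset.prod_ne_zero_iff.2 fun s _ => hτ s)]
  simp [chartSet, firstAt, h, scale, hτ]

/-- An admissible derivative must avoid the normalised coordinates. If all admissible ones vanished,
Euler's relation in each block with `F = 0` would kill the remaining ones too. -/
theorem exists_mem_chartSet {t : Coord n → ℚ_[p]} (ht : ∀ s, ∃ i, t (s, i) ≠ 0) (h0 : F α t = 0)
    (h1 : ∃ m, dF α m t ≠ 0) : ∃ q, t ∈ chartSet α p q := by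
  have h2 (s : Fin 3) : ∃ i, t (s, i) ≠ 0 ∧ ∀ j < i, t (s, j) = 0 := by
    obtain ⟨i, hi, hmin⟩ := (wellFounded_lt (α := Fin (n + 1))).has_min {i | t (s, i) ≠ 0} (ht s)
    exact ⟨i, hi, fun j hj => by_contra fun h => hmin j h hj⟩
  choose c hc using h2
  have h3 : ∃ l : Coord n, l.2 ≠ c l.1 ∧ dF α l t ≠ 0 := by
    by_contra h
    push Not at h
    obtain ⟨m, hm⟩ := h1
    by_cases hmc : m.2 = c m.1
    · have h4 := sum_mul_dF α m.1 t
      rw [Finset.sum_eq_single m.2 (fun i _ hi => by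
        rw [h (m.1, i) fun hic => hi (hic.trans hmc.symm), mul_zero]) (by simp), h0] at h4
      refine (mul_ne_zero ?_ hm) h4
      rw [hmc]; exact (hc m.1).1
    · exact hm (h m hmc)
  obtain ⟨m, hm⟩ := exists_mem_firstAt (P := fun l t => l.2 ≠ c l.1 ∧ dF α l t ≠ 0) h3
  exact ⟨⟨(c, m), hm.1.1⟩, hm, hc⟩

theorem pairwise_disjoint_chartSet : Pairwise (Function.onFun Disjoint (chartSet α p)) := by
  intro q q' hq
  refine Set.disjoint_left.2 fun t ht ht' => hq ?_
  have hc : q.1.1 = q'.1.1 := by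
    funext s
    rcases lt_trichotomy (q.1.1 s) (q'.1.1 s) with h | h | h
    · exact absurd ((ht'.2 s).2 _ h) (ht.2 s).1
    · exact h
    · exact absurd ((ht.2 s).2 _ h) (ht'.2 s).1
  refine Subtype.ext (Prod.ext hc (by_contra fun hm => ?_))
  have h1 := ht.1
  rw [hc] at h1
  exact Set.disjoint_left.1 (pairwise_disjoint_firstAt _ hm) h1 ht'.1

variable {α} in
theorem IsSmoothHypersurface.leray_box_eq_sum (hV : IsSmoothHypersurface α) :
    leray α p (box n p Finset.univ) =
      ∑ q, leray α p (box n p Finset.univ ∩ chartSet α p q) := by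
  have hB := (isClopen_box (n := n) (p := p) Finset.univ).isOpen.measurableSet
  have hU : MeasurableSet (⋃ q, chartSet α p q) := MeasurableSet.iUnion (measurableSet_chartSet α)
  rw [← measure_inter_add_sdiff _ hU, leray_eq_zero α (hB.diff hU), add_zero, Set.inter_iUnion,
    measure_iUnion _ fun q => hB.inter (measurableSet_chartSet α q), tsum_fintype]
  · exact fun q q' hq => (pairwise_disjoint_chartSet α hq).mono Set.inter_subset_right
      Set.inter_subset_right
  · intro t ht hF
    have ht' : ∀ s, ∃ i, t (s, i) ≠ 0 := fun s => by
      obtain ⟨i, hi⟩ := ht.1.2 s (Finset.mem_univ s)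
      exact ⟨i, norm_ne_zero_iff.1 (by rw [hi]; exact one_ne_zero)⟩
    obtain ⟨q, hq⟩ := exists_mem_chartSet α ht' hF (hV.exists_dF_ne_zero p t ht' hF)
    exact ht.2 (Set.mem_iUnion.2 ⟨q, hq⟩)

theorem leray_inter_chartSet (q : Chart n) {B : Set (Coord n → ℚ_[p])} (hB : MeasurableSet B) :
    leray α p (B ∩ chartSet α p q) =
      ∫⁻ v, ∫⁻ τ, (∏ l : q.Param, ‖τ l.1.1‖ₑ) *
        (B ∩ chartSet α p q).indicator (fun t => ‖dF α q.1.2 t‖ₑ⁻¹)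
          (scale τ (chartPoint α q v))
        ∂(Measure.pi fun _ => haar p) ∂(Measure.pi fun _ => haar p) := by
  have hm := hB.inter (measurableSet_chartSet α (p := p) q)
  have hg : Measurable ((B ∩ chartSet α p q).indicator fun t => ‖dF α q.1.2 t‖ₑ⁻¹) :=
    (continuous_dF α q.1.2).measurable.enorm.inv.indicator hm
  rw [← lintegral_comp_conePoint α q hg
    fun t s h => Set.indicator_of_notMem (fun ht => (ht.2.2 s).1 h) _,
    leray_eq_lam α hm (fun t ht => dF_ne_zero_of_mem_chartSet α ht.2), lam_apply α _ hm]
  have : {u : {l : Coord n // l ≠ q.1.2} → ℚ_[p] | dF α q.1.2 (conePoint α q.1.2 u) ≠ 0 ∧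
      conePoint α q.1.2 u ∈ B ∩ chartSet α p q} =
      conePoint α q.1.2 ⁻¹' (B ∩ chartSet α p q) := by
    ext u
    exact ⟨fun h => h.2, fun h => ⟨dF_ne_zero_of_mem_chartSet α h.2, h⟩⟩
  rw [this, ← lintegral_indicator (measurable_conePoint α _ hm)]
  rfl

/-- Of the `n + 1` coordinates in each block one is normalised, and `m` is removed from its own
block. The Jacobian thus lacks one factor `x m.1`, exactly the one missing from the scaling factor
of `∂F/∂t_m`. -/
theorem prod_param (q : Chart n) {x : Fin 3 → ℝ≥0∞} (h0 : ∀ s, x s ≠ 0) (h1 : ∀ s, x s ≠ ∞) :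
    (∏ l : q.Param, x l.1.1) * (∏ s ∈ Finset.univ.erase q.1.2.1, x s)⁻¹ =
      (∏ s, x s) ^ n * (∏ s, x s)⁻¹ := by
  have hX0 : ∏ s, x s ≠ 0 := Finset.prod_ne_zero_iff.2 fun s _ => h0 s
  have hX1 : ∏ s, x s ≠ ∞ := ENNReal.prod_ne_top fun s _ => h1 s
  have h2 : ∏ l : Coord n, x l.1 = (∏ s, x s) ^ (n + 1) := by
    rw [Fintype.prod_prod_type]
    simp [Finset.prod_pow]
  rw [Fintype.prod_eq_mul_prod_subtype_ne _ q.1.2, prod_coord_ne q (fun l => x l.1.1), pow_succ,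
    mul_left_comm, mul_comm _ (∏ s, x s)] at h2
  have h3 : (∏ l : q.Param, x l.1.1) * x q.1.2.1 = (∏ s, x s) ^ n := by
    rw [mul_comm]
    exact (ENNReal.mul_right_inj hX0 hX1).1 h2
  rw [← h3, ← Finset.mul_prod_erase Finset.univ x (Finset.mem_univ q.1.2.1),
    ENNReal.mul_inv (Or.inl (h0 _)) (Or.inl (h1 _))]
  calc _ = (x q.1.2.1 * (x q.1.2.1)⁻¹) * ((∏ l : q.Param, x l.1.1) *
        (∏ s ∈ Finset.univ.erase q.1.2.1, x s)⁻¹) := by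
        rw [ENNReal.mul_inv_cancel (h0 _) (h1 _), one_mul]
    _ = _ := by ring

theorem enorm_prod_eq (S : Finset (Fin 3)) (f : Fin 3 → ℚ_[p]) :
    ‖∏ s ∈ S, f s‖ₑ = ∏ s ∈ S, ‖f s‖ₑ := by
  induction S using Finset.cons_induction with
  | empty => simp
  | cons a S ha ih => simp only [Finset.prod_cons, enorm_mul, ih]

theorem pi_haar_setOf_forall_norm_mul_eq_one {y : Fin 3 → ℚ_[p]} (hy : ∀ s, y s ≠ 0) :
    (Measure.pi fun _ : Fin 3 => haar p) {τ | ∀ s, ‖y s * τ s‖ = 1} =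
      (∏ s, ‖y s‖ₑ)⁻¹ * ENNReal.ofReal ((1 - 1 / p) ^ 3) := by
  have h : {τ : Fin 3 → ℚ_[p] | ∀ s, ‖y s * τ s‖ = 1} =
      Set.univ.pi fun s => (y s * ·) ⁻¹' {x | ‖x‖ = 1} := by
    ext; simp
  have hm : MeasurableSet {x : ℚ_[p] | ‖x‖ = 1} :=
    (isClopen_setOf_norm_eq continuous_id one_ne_zero).isOpen.measurableSet
  have hp1 : (0 : ℝ) ≤ 1 - 1 / p := by
    rw [sub_nonneg, div_le_one (by exact_mod_cast hp.out.pos)]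
    exact_mod_cast hp.out.one_le
  rw [h, Measure.pi_pi]
  simp only [haar_preimage_mul (hy _) hm, haar_setOf_norm_eq_one]
  rw [Finset.prod_mul_distrib, ENNReal.prod_inv_distrib fun i _ j _ _ => Or.inr (by simp),
    ENNReal.ofReal_pow hp1]
  simp

theorem exists_max_block {t : Coord n → ℚ_[p]} (ht : ∀ s, ∃ i, t (s, i) ≠ 0) :
    ∃ y : Fin 3 → ℚ_[p], (∀ s, y s ≠ 0) ∧ (∀ s, ∃ i, t (s, i) = y s) ∧
      ∀ s i, ‖t (s, i)‖ ≤ ‖y s‖ := by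
  have key (s : Fin 3) : ∃ i, ∀ j, ‖t (s, j)‖ ≤ ‖t (s, i)‖ := by
    obtain ⟨i, -, hi⟩ := Finset.exists_max_image Finset.univ (fun i => ‖t (s, i)‖)
      Finset.univ_nonempty
    exact ⟨i, fun j => hi j (Finset.mem_univ j)⟩
  choose i hi using key
  refine ⟨fun s => t (s, i s), fun s => ?_, fun s => ⟨i s, rfl⟩, hi⟩
  obtain ⟨j, hj⟩ := ht s
  exact norm_pos_iff.1 ((norm_pos_iff.2 hj).trans_le (hi s j))

theorem height_eq {t : Coord n → ℚ_[p]} {y : Fin 3 → ℚ_[p]} (h1 : ∀ s, ∃ i, t (s, i) = y s)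
    (h2 : ∀ s i, ‖t (s, i)‖ ≤ ‖y s‖) : height t = (∏ s, ‖y s‖ₑ) ^ n := by
  rw [height, Finset.prod_pow]
  congr 1
  refine Finset.prod_congr rfl fun s _ => le_antisymm (iSup_le fun i => ?_) ?_
  · rw [← ofReal_norm, ← ofReal_norm]
    exact ENNReal.ofReal_le_ofReal (h2 s i)
  · obtain ⟨i, hi⟩ := h1 s
    rw [← hi]
    exact le_iSup (fun i => ‖t (s, i)‖ₑ) i

theorem scale_mem_box_iff {t : Coord n → ℚ_[p]} {y τ : Fin 3 → ℚ_[p]}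
    (h1 : ∀ s, ∃ i, t (s, i) = y s) (h2 : ∀ s i, ‖t (s, i)‖ ≤ ‖y s‖) :
    scale τ t ∈ box n p Finset.univ ↔ ∀ s, ‖y s * τ s‖ = 1 := by
  have h3 (s : Fin 3) (i : Fin (n + 1)) : ‖scale τ t (s, i)‖ ≤ ‖y s * τ s‖ := by
    rw [scale, norm_mul, norm_mul, mul_comm]
    exact mul_le_mul_of_nonneg_right (h2 s i) (norm_nonneg _)
  constructor
  · intro h s
    obtain ⟨i, hi⟩ := h1 s
    obtain ⟨j, hj⟩ := h.2 s (Finset.mem_univ s)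
    have h4 := h.1 (s, i)
    rw [scale, hi, mul_comm] at h4
    exact le_antisymm h4 (hj ▸ h3 s j)
  · intro h
    refine ⟨fun l => (h3 l.1 l.2).trans (h l.1).le, fun s _ => ?_⟩
    obtain ⟨i, hi⟩ := h1 s
    exact ⟨i, by rw [scale, hi, mul_comm, h]⟩

/-- With `y_s` an entry of maximal norm in block `s` and `Y = ∏ |y_s|`, primitivity of the rescaled
point means `|τ_s| = |y_s|⁻¹`. The integrand is then the constant `Y⁻ⁿ Y / |∂F/∂t_m|` on a set of
volume `Y⁻¹ (1 - 1/p)^3`, and `Yⁿ` is the height. -/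
theorem lintegral_scale_box (q : Chart n) (t : Coord n → ℚ_[p]) :
    ∫⁻ τ, (∏ l : q.Param, ‖τ l.1.1‖ₑ) *
      (box n p Finset.univ ∩ chartSet α p q).indicator (fun t => ‖dF α q.1.2 t‖ₑ⁻¹) (scale τ t)
        ∂(Measure.pi fun _ => haar p) =
    ENNReal.ofReal ((1 - 1 / p) ^ 3) *
      (chartSet α p q).indicator (fun t => (height t * ‖dF α q.1.2 t‖ₑ)⁻¹) t := by
  by_cases ht : t ∈ chartSet α p q
  · obtain ⟨y, hy, h1, h2⟩ := exists_max_block fun s => ⟨_, (ht.2 s).1⟩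
    set D := ‖dF α q.1.2 t‖ₑ
    set Y := ∏ s, ‖y s‖ₑ with hY
    have hY0 : Y ≠ 0 := Finset.prod_ne_zero_iff.2 fun s _ => by simpa using hy s
    have hY1 : Y ≠ ∞ := ENNReal.prod_ne_top fun s _ => enorm_ne_top
    have hD0 : D ≠ 0 := by simpa [D] using dF_ne_zero_of_mem_chartSet α ht
    have hS : MeasurableSet {τ : Fin 3 → ℚ_[p] | ∀ s, ‖y s * τ s‖ = 1} := by
      simp only [Set.ofPred_forall]
      exact MeasurableSet.iInter fun s => (isClopen_setOf_norm_eq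
        (f := fun τ : Fin 3 → ℚ_[p] => y s * τ s) (by fun_prop) one_ne_zero).isOpen.measurableSet
    have h3 (τ : Fin 3 → ℚ_[p]) : (∏ l : q.Param, ‖τ l.1.1‖ₑ) *
        (box n p Finset.univ ∩ chartSet α p q).indicator (fun t => ‖dF α q.1.2 t‖ₑ⁻¹) (scale τ t) =
        {τ : Fin 3 → ℚ_[p] | ∀ s, ‖y s * τ s‖ = 1}.indicator
          (fun _ => Y⁻¹ ^ n * Y * D⁻¹) τ := by
      by_cases hτ : ∀ s, ‖y s * τ s‖ = 1
      · have hτ0 (s : Fin 3) : τ s ≠ 0 := fun h => by simpa [h] using hτ s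
        have hτe (s : Fin 3) : ‖τ s‖ₑ = ‖y s‖ₑ⁻¹ := by
          refine ENNReal.eq_inv_of_mul_eq_one_left ?_
          rw [mul_comm, ← enorm_mul, ← ofReal_norm, hτ, ENNReal.ofReal_one]
        have hprod : ∏ s, ‖τ s‖ₑ = Y⁻¹ := by
          simp only [hτe]
          exact (ENNReal.prod_inv_distrib fun i _ j _ _ => Or.inr enorm_ne_top).symm
        rw [Set.indicator_of_mem (show τ ∈ {τ : Fin 3 → ℚ_[p] | ∀ s, ‖y s * τ s‖ = 1} from hτ),
          Set.indicator_of_mem (show scale τ t ∈ box n p Finset.univ ∩ chartSet α p q from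
            ⟨(scale_mem_box_iff h1 h2).2 hτ, (scale_mem_chartSet_iff α q hτ0 t).2 ht⟩),
          dF_scale, enorm_mul, ENNReal.mul_inv (Or.inr enorm_ne_top) (Or.inr hD0), ← mul_assoc,
          enorm_prod_eq, prod_param q (x := fun s => ‖τ s‖ₑ) (fun s => by simpa using hτ0 s)
            (fun s => enorm_ne_top), hprod, inv_inv]
      · rw [Set.indicator_of_notMem (show τ ∉ {τ : Fin 3 → ℚ_[p] | ∀ s, ‖y s * τ s‖ = 1} from hτ),
          Set.indicator_of_notMem (fun h => hτ ((scale_mem_box_iff h1 h2).1 h.1)), mul_zero]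
    simp only [h3]
    rw [lintegral_indicator_const hS, pi_haar_setOf_forall_norm_mul_eq_one hy, ← hY,
      Set.indicator_of_mem ht, height_eq h1 h2, ← hY,
      ENNReal.mul_inv (Or.inr enorm_ne_top) (Or.inr hD0), ENNReal.inv_pow]
    calc _ = (Y * Y⁻¹) * (ENNReal.ofReal ((1 - 1 / p) ^ 3) * (Y⁻¹ ^ n * D⁻¹)) := by ring
      _ = _ := by rw [ENNReal.mul_inv_cancel hY0 hY1, one_mul]
  · rw [Set.indicator_of_notMem ht, mul_zero, ← lintegral_zero]
    refine lintegral_congr fun τ => ?_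
    rw [Set.indicator_of_notMem, mul_zero]
    intro h
    refine ht ((scale_mem_chartSet_iff α q (fun s hs => (h.2.2 s).1 ?_) t).1 h.2)
    rw [scale, hs, zero_mul]

theorem measurable_chartMap (q : Chart n) :
    Measurable (chartMap α q : (q.Param → ℚ_[p]) → _) := by
  refine measurable_pi_lambda _ fun s => ?_
  have h1 : Measurable fun u : q.Param → ℚ_[p] =>
      (⟨fun i => chartPoint α q u (s, i), chartPoint_block_ne_zero α q u s⟩ :
        {v : Fin (n + 1) → ℚ_[p] // v ≠ 0}) :=
    Measurable.subtype_mk (measurable_pi_lambda _ fun i =>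
      (measurable_pi_apply (s, i)).comp (measurable_chartPoint α q))
  have h2 : Measurable (Projectivization.mk' ℚ_[p] :
      {v : Fin (n + 1) → ℚ_[p] // v ≠ 0} → ℙ ℚ_[p] (Fin (n + 1) → ℚ_[p])) := fun _ h => h
  exact h2.comp h1

theorem chartMap_mem_padicPoints (q : Chart n) (u : q.Param → ℚ_[p])
    (h : dF α q.1.2 (chartPoint α q u) ≠ 0) : chartMap α q u ∈ padicPoints α p := by
  -- The chosen representatives differ from the normalised coordinates by one unit per block, which
  -- only rescales `F`.
  choose a ha using fun s => Projectivization.exists_smul_eq_mk_rep ℚ_[p] _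
    (chartPoint_block_ne_zero α q u s)
  have h1 : (fun l : Coord n => (chartMap α q u l.1).rep l.2) =
      scale (fun s => (a s : ℚ_[p])) (chartPoint α q u) := by
    funext l
    exact (congrFun (ha l.1) l.2).symm
  rw [chartPoint_eq, dF_solve] at h
  rw [padicPoints, Set.mem_ofPred_eq, h1, F_scale, chartPoint_eq, F_solve α _ _ h, mul_zero]

theorem omega_padicPoints :
    omega α p (padicPoints α p) = ∑ q : Chart n, ∫⁻ v : q.Param → ℚ_[p],
      (chartSet α p q).indicator (fun t => (height t * ‖dF α q.1.2 t‖ₑ)⁻¹) (chartPoint α q v)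
        ∂(Measure.pi fun _ => haar p) := by
  rw [omega, Measure.finsetSum_apply]
  refine Finset.sum_congr rfl fun q _ => ?_
  have hset : {u : q.Param → ℚ_[p] | dF α q.1.2 (chartPoint α q u) ≠ 0 ∧
      (∀ l : Coord n, l.2 ≠ q.1.1 l.1 → toLex l < toLex q.1.2 → dF α l (chartPoint α q u) = 0) ∧
      ∀ s, ∀ i < q.1.1 s, chartPoint α q u (s, i) = 0} =
      chartPoint α q ⁻¹' chartSet α p q := by
    ext u
    simp only [chartSet, firstAt, Set.mem_ofPred_eq, Set.mem_preimage, Set.mem_inter_iff,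
      chartPoint_normalised, not_and, not_not, ne_eq, one_ne_zero, not_false_eq_true, true_and]
    have := q.2
    tauto
  have hm := measurable_chartPoint α (p := p) q (measurableSet_chartSet α q)
  rw [hset]
  set ν := ((Measure.pi fun _ : q.Param => haar p).restrict
    (chartPoint α q ⁻¹' chartSet α p q)).withDensity
      fun u => (height (chartPoint α q u) * ‖dF α q.1.2 (chartPoint α q u)‖ₑ)⁻¹ with hν
  -- Almost every parameter lands in `V(ℚ_p)`, so the mass of `V(ℚ_p)` is the total mass; bounding
  -- it from both sides avoids any appeal to measurability of `V(ℚ_p)`.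
  have hae : ∀ᵐ u ∂ν, chartMap α q u ∈ padicPoints α p := by
    refine (withDensity_absolutelyContinuous _ _).ae_le ?_
    exact ae_restrict_of_forall_mem hm fun u hu =>
      chartMap_mem_padicPoints α q u (dF_ne_zero_of_mem_chartSet α hu)
  have h1 : ν.map (chartMap α q) (padicPoints α p) = ν Set.univ := by
    refine le_antisymm ?_ ?_
    · refine (measure_mono (Set.subset_univ _)).trans ?_
      rw [Measure.map_apply (measurable_chartMap α q) MeasurableSet.univ, Set.preimage_univ]
    · refine le_trans (le_of_eq ?_) (Measure.le_map_apply (measurable_chartMap α q).aemeasurable _)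
      exact (measure_congr (eventuallyEq_univ.2 hae)).symm
  rw [h1, hν, withDensity_apply _ MeasurableSet.univ, Measure.restrict_univ,
    ← lintegral_indicator hm]
  rfl

variable {α} in
-- Both sides are sums over the same disjoint charts, and the integral over the scaling parameters
-- matches them term by term.
theorem IsSmoothHypersurface.tamagawa_padicPoints (hV : IsSmoothHypersurface α) :
    tamagawa α p (padicPoints α p) = leray α p (box n p Finset.univ) := by
  rw [tamagawa, Measure.smul_apply, smul_eq_mul, omega_padicPoints, Finset.mul_sum,
    hV.leray_box_eq_sum]
  refine Finset.sum_congr rfl fun q _ => ?_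
  rw [leray_inter_chartSet α q (isClopen_box _).isOpen.measurableSet,
    ← lintegral_const_mul' _ _ ENNReal.ofReal_ne_top]
  simp only [lintegral_scale_box]

end Tamagawa

end TriProj

theorem mainTheorem8 (n : ℕ) (hn : 1 ≤ n)
    (α : Fin (n + 1) → Fin (n + 1) → Fin (n + 1) → ℤ)
    (hV : TriProj.IsSmoothHypersurface α) (p : ℕ) [Fact p.Prime] :
    -- the series defining `σ_p` converges absolutely, the integrals are finite
    Summable (fun k : ℕ => TriProj.A α (p ^ k)) ∧
    TriProj.leray α p (TriProj.integralCone α p) ≠ ∞ ∧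
    TriProj.tamagawa α p (TriProj.padicPoints α p) ≠ ∞ ∧
    -- `σ_p` is the integral of the Leray measure over the integral cone
    TriProj.localDensity α p =
      (((TriProj.leray α p).real (TriProj.integralCone α p) : ℝ) : ℂ) ∧
    -- the primitive version of the integral
    (TriProj.leray α p).real (TriProj.primitiveCone α p) =
      (1 - 1 / (p : ℝ) ^ n) ^ 3 * (TriProj.leray α p).real (TriProj.integralCone α p) ∧
    -- the limit of the primitive point counts
    Tendsto (fun r : ℕ => (TriProj.primCount α p r : ℂ) / (p : ℂ) ^ (r * (3 * n + 2))) atTop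
      (𝓝 ((1 - 1 / (p : ℂ) ^ n) ^ 3 * TriProj.localDensity α p)) ∧
    -- the Tamagawa volume of `V(ℚ_p)`
    (((TriProj.tamagawa α p).real (TriProj.padicPoints α p) : ℝ) : ℂ) =
      (1 - 1 / (p : ℂ) ^ n) ^ 3 * TriProj.localDensity α p := by
  have hI := TriProj.leray_integralCone (α := α) (p := p)
  have hP := TriProj.leray_primitiveCone (α := α) (p := p)
  have hT := hV.tamagawa_padicPoints (p := p)
  have hA := hV.hasSum_A (p := p) hn
  have hbox := hV.toReal_leray_box (p := p) hn
  have hq : (1 - ((p : ℝ) ^ n)⁻¹) ≠ 0 :=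
    (sub_pos.2 (TriProj.prime_pow_real_inv_lt_one (p := p) hn)).ne'
  have hprim : (TriProj.leray α p (TriProj.box n p Finset.univ)).toReal =
      (1 - 1 / (p : ℝ) ^ n) ^ 3 * (TriProj.leray α p (TriProj.box n p ∅)).toReal := by
    rw [hbox, one_div, ← mul_assoc, ← mul_pow, mul_inv_cancel₀ hq, one_pow, one_mul]
  -- The Leray mass of the primitive box is both the limit of the point counts and the Tamagawa
  -- volume, so this one identity serves for both.
  have hprimC : ((TriProj.leray α p (TriProj.box n p Finset.univ)).toReal : ℂ) =
      (1 - 1 / (p : ℂ) ^ n) ^ 3 * TriProj.localDensity α p := by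
    rw [TriProj.localDensity, hA.tsum_eq, hprim]
    push_cast
    rfl
  refine ⟨hA.summable, ?_, ?_, ?_, ?_, ?_, ?_⟩
  · rw [hI]; exact hV.leray_box_ne_top hn
  · rw [hT]; exact hV.leray_box_univ_ne_top
  · rw [TriProj.localDensity, hA.tsum_eq, Measure.real, hI]
  · rw [Measure.real, Measure.real, hI, hP, hprim]
  · rw [← hprimC]; exact hV.tendsto_primCount
  · rw [Measure.real, hT, hprimC]
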